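/- Let the potential $Q$ be either $$Q(\lambda)=4\lambda^3-2\lambda z+2zy-4y^3+y'^2+\frac{y'}{\lambda-y}+\frac{3}{4(\lambda-y)^2}$$ with arbitrary complex constants $y,y',z$ (the perturbed cubic oscillator), or $Q(\lambda)=4\lambda^3-a\lambda-b$ with arbitrary complex constants $a,b$ (the cubic oscillator). Let $f:\mathbb C\to\mathbb C\cup\{\infty\}$ be a nonconstant meromorphic function satisfying the Schwarzian equation $$\frac{f'''}{f'}-\frac32\Big(\frac{f''}{f'}\Big)^2=-2Q .$$ For $k\in\mathbb Z_5$ (the integers modulo five) let $S_k=\{\lambda\ne0:\ |\arg\lambda-\tfrac{2\pi k}{5}|<\tfrac{\pi}{5}\}$, angles being taken modulo $2\pi$. Call a continuous curve $\gamma:[0,\infty)\to S_k$ with $|\gamma(t)|\to\infty$ non-tangential to the boundary of $S_k$ if there is $\varepsilon>0$ with $|\arg\gamma(t)-\tfrac{2\pi k}{5}|\le\tfrac{\pi}{5}-\varepsilon$ for all large $t$. Then: (i) For every $k\in\mathbb Z_5$ there is exactly one $w_k(f)\in\mathbb C\cup\{\infty\}$ such that $f(\gamma(t))\to w_k(f)$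 as $t\to\infty$ for every such non-tangential curve $\gamma$ in $S_k$. (ii) $w_{k+1}(f)\neq w_k(f)$ for every $k\in\mathbb Z_5$. (iii) If $\begin{pmatrix}a&b\\c&d\end{pmatrix}\in GL(2,\mathbb C)$ and $g=\frac{af+b}{cf+d}$, then for every $k\in\mathbb Z_5$ the limit $w_k(g)$ exists in the sense of (i), and $w_k(g)=\frac{a\,w_k(f)+b}{c\,w_k(f)+d}$. (iv) For every $k\in\mathbb Z_5$ and every ray $\lambda(t)=\lambda_0+te^{i\alpha}$, $t>0$ ($\lambda_0\in\mathbb C$, $\alpha\in\mathbb R$), contained in $S_k$, the convergence of $f(\lambda(t))$ to $w_k(f)$ is super-exponential: for every $C\in\mathbb R$, $e^{Ct}\,d\big(f(\lambda(t)),w_k(f)\big)\to0$ as $t\to\infty$, where $d$ is the chordal distance on the Riemann sphere $\mathbb C\cup\{\infty\}$. -/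

import Mathlib

open Filter Topology Set
open scoped OnePoint MatrixGroups

/-- The data of an oscillator: either the perturbed cubic oscillator with parameters `y, y', z`
(here `y'` is just a complex number) or its degenerate case, the cubic oscillator with
parameters `a, b`. -/
inductive Oscillator : Type
  | perturbed (y y' z : ℂ) : Oscillator
  | cubic (a b : ℂ) : Oscillator

/-- The potential of an oscillator. In the perturbed case it has its only pole at `y`. -/
noncomputable def Oscillator.potential : Oscillator → ℂ → ℂ
  | .perturbed y y' z => fun l =>
      4 * l ^ 3 - 2 * l * z + 2 * z * y - 4 * y ^ 3 + y' ^ 2 + y' / (l - y)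
        + 3 / (4 * (l - y) ^ 2)
  | .cubic a b => fun l => 4 * l ^ 3 - a * l - b

/-- The Schwarzian derivative `F'''/F' - (3/2) (F''/F')^2`. -/
noncomputable def schwarzian (F : ℂ → ℂ) (l : ℂ) : ℂ :=
  iteratedDeriv 3 F l / deriv F l - 3 / 2 * (iteratedDeriv 2 F l / deriv F l) ^ 2

/-- The map `f` from `ℂ` to the Riemann sphere `OnePoint ℂ` is a (nonconstant, meromorphic)
solution of the Schwarzian equation `{f, l} = -2 Q(l)`. The function `F` represents `f` as a
meromorphic function in Mathlib's sense, whose value at poles and removable singularities is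
irrelevant; the value of `f` at each point, `∞` at a pole, is the limit of `F` there.
The differential equation is an identity between meromorphic functions, that is, it holds
outside a closed discrete set. -/
def IsSchwarzianSolution (O : Oscillator) (f : ℂ → OnePoint ℂ) : Prop :=
  (∃ F : ℂ → ℂ, Meromorphic F ∧
    (∀ l : ℂ, Tendsto (fun x : ℂ => (F x : OnePoint ℂ)) (𝓝[≠] l) (𝓝 (f l))) ∧
    ∀ᶠ l in codiscrete ℂ, schwarzian F l = -2 * O.potential l) ∧
  ¬ ∃ c : OnePoint ℂ, ∀ l : ℂ, f l = c

/-- The angle, in `(-π, π]`, between `l` and the bisector `arg = 2 π k / 5` of the `k`-th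
Stokes sector. -/
noncomputable def stokesAngle (k : ZMod 5) (l : ℂ) : ℝ :=
  Complex.arg (l * Complex.exp (-(2 * Real.pi * (k.val : ℂ) / 5 * Complex.I)))

/-- The `k`-th Stokes sector `{l ≠ 0 : |arg l - 2 π k / 5| < π / 5}`, angles being taken
modulo `2 π`. -/
def stokesSector (k : ZMod 5) : Set ℂ :=
  {l | l ≠ 0 ∧ |stokesAngle k l| < Real.pi / 5}

/-- A curve `[0, ∞) → S_k` that tends to infinity and is non-tangential to the boundary of
`S_k`: eventually its angular distance from the boundary is bounded below. -/
structure IsNontangentialCurve (k : ZMod 5) (γ : ℝ → ℂ) : Prop where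
  continuousOn : ContinuousOn γ (Ici 0)
  mem_sector : ∀ t : ℝ, 0 ≤ t → γ t ∈ stokesSector k
  tendsto_infinity : Tendsto (fun t => ‖γ t‖) atTop atTop
  nontangential : ∃ ε : ℝ, 0 < ε ∧ ∀ᶠ t in atTop, |stokesAngle k (γ t)| ≤ Real.pi / 5 - ε

/-- `w` is the `k`-th asymptotic value of `f`: the limit of `f` at infinity along every curve
in `S_k` that is non-tangential to the boundary. -/
def IsAsymptoticValue (f : ℂ → OnePoint ℂ) (k : ZMod 5) (w : OnePoint ℂ) : Prop :=
  ∀ γ : ℝ → ℂ, IsNontangentialCurve k γ → Tendsto (fun t => f (γ t)) atTop (𝓝 w)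

/-- The chordal distance on the Riemann sphere. -/
noncomputable def chordalDist : OnePoint ℂ → OnePoint ℂ → ℝ
  | OnePoint.infty, OnePoint.infty => 0
  | OnePoint.infty, OnePoint.some u => 2 / √(1 + ‖u‖ ^ 2)
  | OnePoint.some u, OnePoint.infty => 2 / √(1 + ‖u‖ ^ 2)
  | OnePoint.some u, OnePoint.some v => 2 * ‖u - v‖ / (√(1 + ‖u‖ ^ 2) * √(1 + ‖v‖ ^ 2))

/-- The point at parameter `t` of the ray with initial point `l₀` and direction
`exp (i α)`. -/
noncomputable def rayPoint (l₀ : ℂ) (α t : ℝ) : ℂ :=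
  l₀ + t * Complex.exp (α * Complex.I)

/-- Along the ray, `f` converges to `w` faster than any exponential. -/
def ConvergesSuperexponentially (f : ℂ → OnePoint ℂ) (l₀ : ℂ) (α : ℝ) (w : OnePoint ℂ) : Prop :=
  ∀ C : ℝ, Tendsto (fun t : ℝ => Real.exp (C * t) * chordalDist (f (rayPoint l₀ α t)) w)
    atTop (𝓝 0)

/-!
The linear equation `φ'' = Q φ` underlies the Schwarzian equation `{f, l} = -2 Q`: the solution `f`
is, locally and then by the identity theorem on a whole domain, a quotient of linear combinations
of any two independent solutions `φ₁, φ₂` (`exists_eq_homog`). Hence `f` is a Möbius transformation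
of `q = φ₁ / φ₂`, and the theorem follows from the asymptotics of `q` for one well-chosen pair.

The pair is attached to the boundary ray of two neighbouring Stokes sectors, spanned by a unit
vector `c` with `c⁵ = -1`. In a cone around this ray, `φ₁` and `φ₂` behave like
`exp (∓ (4/5) i (l/c)^{5/2})` up to a factor `exp (O(|l|))`, so that
`log |q| = (8/5) Im (l/c)^{5/2} + O(|l|)` (`exists_quotient_on_cone`): `q` tends
to `∞` on one side of the ray and to `0` on the other.
Therefore `f` tends to the images of `∞` and `0` under one Möbius transformation, which are
different (`exists_decaysTo_aboveRay_belowRay`). At an angle at most `π/5` from the ray and at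
distance at least `δ` from it, the leading term of `log |q|` has modulus at least
`(8/5) δ |l|^{3/2}`. This dominates `O(|l|)`, so the convergence is superexponential even along
rays parallel to the boundary of the sector. Each sector consists of two halves, one for each
boundary ray; the two limits agree on the bisector.

Only the crude error `O(|l|)` is needed, so no full asymptotic expansion of `φ₁` and `φ₂` is.
They are `exp (∫ v)` for solutions `v` of the Riccati equation `v' = Q - v²` that stay at bounded
distance from `∓ (2i/c) (l/c)^{3/2}`. In the variable `y = (l/C)^{5/2}`, with `C` a suitable unit
vector near `c`, the remainder `w` solves `w' = κ w - (a w² + b)` where `Re κ > 0` and `a`, `b` tend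
to `0`. The bounded solution is the fixed point of
`w ↦ ∫₀^∞ e^{-κt} (a w² + b)(y + t) dt` (`exists_bounded_riccati`). The integral runs over
horizontal half-lines, so the domain must be invariant under translation by positive reals. The
image of the sector of half-angle `7π/20` around `C` lies in such a domain, far from the origin,
and for `C = c e^{∓iπ/10}` this sector contains the cone of half-angle `π/4` around `c`. The two
signs give the two solutions.
-/

/-! ### Bounded solutions of a Riccati equation -/

/-- The Laplace-type transform `z ↦ ∫₀^∞ e^{-κt} N(z + t) dt`. Applied to bounded holomorphic `N`
it gives the bounded solution of `w' = κ w - N`. -/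
noncomputable def forwardLaplace (κ : ℂ) (N : ℂ → ℂ) (z : ℂ) : ℂ :=
  ∫ t in Ioi (0 : ℝ), Complex.exp (-κ * t) * N (z + t)

lemma norm_exp_neg_mul_ofReal (κ : ℂ) (t : ℝ) :
    ‖Complex.exp (-κ * t)‖ = Real.exp (-κ.re * t) := by
  rw [Complex.norm_exp]; simp

section ForwardLaplace

variable {X : Set ℂ} {κ : ℂ} {N : ℂ → ℂ} {M : ℝ}

lemma integrable_exp_mul_real (hκ : 0 < κ.re) (M : ℝ) :
    MeasureTheory.IntegrableOn (fun t : ℝ => Real.exp (-κ.re * t) * M) (Ioi 0) :=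
  (integrableOn_exp_mul_Ioi (by linarith) 0).mul_const M

lemma continuousOn_exp_mul_translate (hXt : ∀ z ∈ X, ∀ t : ℝ, 0 ≤ t → z + t ∈ X)
    (hN : ContinuousOn N X) {z : ℂ} (hz : z ∈ X) :
    ContinuousOn (fun t : ℝ => Complex.exp (-κ * t) * N (z + t)) (Ici 0) := by
  refine ContinuousOn.mul (by fun_prop) (hN.comp (by fun_prop) fun t ht => hXt z hz t ht)

lemma integrable_forwardLaplace (hXt : ∀ z ∈ X, ∀ t : ℝ, 0 ≤ t → z + t ∈ X)
    (hκ : 0 < κ.re) (hN : ContinuousOn N X) (hM : ∀ z ∈ X, ‖N z‖ ≤ M) {z : ℂ} (hz : z ∈ X) :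
    MeasureTheory.IntegrableOn (fun t : ℝ => Complex.exp (-κ * t) * N (z + t)) (Ioi 0) := by
  refine MeasureTheory.Integrable.mono' (integrable_exp_mul_real hκ M)
    (((continuousOn_exp_mul_translate hXt hN hz).mono Ioi_subset_Ici_self).aestronglyMeasurable
      measurableSet_Ioi) ?_
  filter_upwards [MeasureTheory.ae_restrict_mem measurableSet_Ioi] with t ht
  rw [norm_mul, norm_exp_neg_mul_ofReal]
  gcongr
  exact hM _ (hXt z hz t (le_of_lt ht))

lemma norm_forwardLaplace_le (hXt : ∀ z ∈ X, ∀ t : ℝ, 0 ≤ t → z + t ∈ X)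
    (hκ : 0 < κ.re) (hM : ∀ z ∈ X, ‖N z‖ ≤ M) {z : ℂ} (hz : z ∈ X) :
    ‖forwardLaplace κ N z‖ ≤ M / κ.re := by
  have h := MeasureTheory.norm_integral_le_of_norm_le (integrable_exp_mul_real hκ M)
    (f := fun t : ℝ => Complex.exp (-κ * t) * N (z + t)) (by
      filter_upwards [MeasureTheory.ae_restrict_mem measurableSet_Ioi] with t ht
      rw [norm_mul, norm_exp_neg_mul_ofReal]
      gcongr
      exact hM _ (hXt z hz t (le_of_lt ht)))
  refine h.trans_eq ?_
  rw [MeasureTheory.integral_mul_const, integral_exp_mul_Ioi (by linarith)]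
  simp
  field_simp

lemma hasDerivAt_forwardLaplace (hX : IsOpen X) (hXt : ∀ z ∈ X, ∀ t : ℝ, 0 ≤ t → z + t ∈ X)
    (hκ : 0 < κ.re) (hN : DifferentiableOn ℂ N X) (hM : ∀ z ∈ X, ‖N z‖ ≤ M)
    {z : ℂ} (hz : z ∈ X) :
    HasDerivAt (forwardLaplace κ N) (κ * forwardLaplace κ N z - N z) z := by
  obtain ⟨δ, hδ, hball⟩ := Metric.isOpen_iff.1 hX z hz
  have hNd : DifferentiableOn ℂ (deriv N) X := hN.deriv hX
  -- Cauchy's estimate, uniform along the translates of a small ball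
  have hderiv : ∀ u ∈ Metric.ball z (δ / 2), ∀ t : ℝ, 0 ≤ t →
      ‖deriv N (u + t)‖ ≤ M / (δ / 4) := by
    intro u hu t ht
    have hsub : Metric.closedBall (u + t) (δ / 4) ⊆ X := by
      intro x hx
      have hx' : x - t ∈ X := hball (by
        rw [Metric.mem_closedBall, dist_eq_norm] at hx
        rw [Metric.mem_ball, dist_eq_norm] at hu ⊢
        calc ‖x - t - z‖ = ‖(x - (u + t)) + (u - z)‖ := by congr 1; ring
          _ ≤ _ := norm_add_le _ _
          _ < δ := by linarith)
      simpa using hXt _ hx' t ht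
    refine Complex.norm_deriv_le_of_forall_mem_sphere_norm_le (by positivity) ?_ ?_
    · exact (hN.mono hsub).diffContOnCl_ball subset_rfl
    · exact fun x hx => hM x (hsub (Metric.sphere_subset_closedBall hx))
  have hmem : ∀ u ∈ Metric.ball z (δ / 2), u ∈ X := fun u hu =>
    hball (Metric.ball_subset_ball (by linarith) hu)
  have key := hasDerivAt_integral_of_dominated_loc_of_deriv_le
    (μ := MeasureTheory.volume.restrict (Ioi (0 : ℝ)))
    (F := fun (u : ℂ) (t : ℝ) => Complex.exp (-κ * t) * N (u + t))
    (F' := fun (u : ℂ) (t : ℝ) => Complex.exp (-κ * t) * deriv N (u + t))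
    (bound := fun t => Real.exp (-κ.re * t) * (M / (δ / 4)))
    (Metric.ball_mem_nhds z (half_pos hδ))
    (by
      filter_upwards [Metric.ball_mem_nhds z (half_pos hδ)] with u hu
      exact (integrable_forwardLaplace hXt hκ hN.continuousOn hM (hmem u hu)).1)
    (integrable_forwardLaplace hXt hκ hN.continuousOn hM hz)
    (((continuousOn_exp_mul_translate hXt hNd.continuousOn hz).mono
      Ioi_subset_Ici_self).aestronglyMeasurable measurableSet_Ioi)
    (by
      filter_upwards [MeasureTheory.ae_restrict_mem measurableSet_Ioi] with t ht u hu
      rw [norm_mul, norm_exp_neg_mul_ofReal]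
      gcongr
      exact hderiv u hu t (le_of_lt ht))
    (integrable_exp_mul_real hκ _)
    (by
      filter_upwards [MeasureTheory.ae_restrict_mem measurableSet_Ioi] with t ht u hu
      have h1 := ((hN _ (hXt u (hmem u hu) t (le_of_lt ht))).differentiableAt
        (hX.mem_nhds (hXt u (hmem u hu) t (le_of_lt ht)))).hasDerivAt
      exact (h1.comp_add_const u (t : ℂ)).const_mul _)
  have hint := integrable_forwardLaplace hXt hκ hN.continuousOn hM hz
  have hlim : Tendsto (fun t : ℝ => Complex.exp (-κ * t) * N (z + t)) atTop (𝓝 0) := by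
    have h0 : Tendsto (fun t : ℝ => Real.exp (-κ.re * t) * M) atTop (𝓝 0) := by
      have : Tendsto (fun t : ℝ => -κ.re * t) atTop atBot :=
        tendsto_id.const_mul_atTop_of_neg (by linarith)
      simpa using (Real.tendsto_exp_atBot.comp this).mul_const M
    refine squeeze_zero_norm' ?_ h0
    filter_upwards [eventually_ge_atTop 0] with t ht
    rw [norm_mul, norm_exp_neg_mul_ofReal]
    gcongr
    exact hM _ (hXt z hz t ht)
  -- integration by parts
  have hparts := MeasureTheory.integral_Ioi_of_hasDerivAt_of_tendsto
    (f := fun t : ℝ => Complex.exp (-κ * t) * N (z + t))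
    (f' := fun t : ℝ => -κ * (Complex.exp (-κ * t) * N (z + t)) +
      Complex.exp (-κ * t) * deriv N (z + t)) (a := 0) (m := 0)
    ((continuousOn_exp_mul_translate hXt hN.continuousOn hz) 0 self_mem_Ici)
    (by
      intro t ht
      have hzt := hXt z hz t (le_of_lt ht)
      have h1 : HasDerivAt (fun t : ℝ => N (z + t)) (deriv N (z + t)) t := by
        have h2 := ((hN _ hzt).differentiableAt (hX.mem_nhds hzt)).hasDerivAt
        exact (h2.comp_const_add z (t : ℂ)).comp_ofReal
      have h3 : HasDerivAt (fun t : ℝ => Complex.exp (-κ * t))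
          (Complex.exp (-κ * t) * (-κ)) t := by
        have h4 : HasDerivAt (fun x : ℂ => Complex.exp (-κ * x))
            (Complex.exp (-κ * t) * (-κ * 1)) (t : ℂ) :=
          ((hasDerivAt_id (t : ℂ)).const_mul (-κ)).cexp
        simpa using h4.comp_ofReal
      exact (h3.mul h1).congr_deriv (by ring))
    ((hint.const_mul _).add key.1) hlim
  rw [MeasureTheory.integral_add (hint.const_mul _) key.1, MeasureTheory.integral_const_mul]
    at hparts
  have h5 : (∫ t in Ioi (0 : ℝ), Complex.exp (-κ * t) * deriv N (z + t)) =
      κ * forwardLaplace κ N z - N z := by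
    simp only [forwardLaplace] 
    simp only [Complex.ofReal_zero, mul_zero, Complex.exp_zero, one_mul, add_zero] at hparts
    linear_combination hparts
  rw [← h5]
  exact key.2

end ForwardLaplace

/-- If `X` is invariant under translations by positive reals, `Re κ > 0`, and the holomorphic
coefficients `a`, `b` are small on `X`, then `w' = κ w - (a w² + b)` has a holomorphic solution
bounded by `1` on `X`: it is the limit of the iterates of a contraction. -/
lemma exists_bounded_riccati {X : Set ℂ} (hX : IsOpen X)
    (hXt : ∀ z ∈ X, ∀ t : ℝ, 0 ≤ t → z + t ∈ X) {κ : ℂ} (hκ : 0 < κ.re) {a b : ℂ → ℂ}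
    (ha : DifferentiableOn ℂ a X) (hb : DifferentiableOn ℂ b X)
    (ha' : ∀ z ∈ X, ‖a z‖ ≤ κ.re / 4) (hb' : ∀ z ∈ X, ‖b z‖ ≤ κ.re / 2) :
    ∃ w : ℂ → ℂ, ∀ z ∈ X, ‖w z‖ ≤ 1 ∧ HasDerivAt w (κ * w z - (a z * w z ^ 2 + b z)) z := by
  let step : (ℂ → ℂ) → ℂ → ℂ := fun w => forwardLaplace κ fun z => a z * w z ^ 2 + b z
  let W : ℕ → ℂ → ℂ := fun n => step^[n] 0
  have hW : ∀ n, W (n + 1) = step (W n) := fun n => Function.iterate_succ_apply' step n 0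
  have hN : ∀ w : ℂ → ℂ, DifferentiableOn ℂ w X →
      DifferentiableOn ℂ (fun z => a z * w z ^ 2 + b z) X := fun w hw =>
    (ha.mul (hw.pow 2)).add hb
  have hNb : ∀ w : ℂ → ℂ, (∀ z ∈ X, ‖w z‖ ≤ 1) → ∀ z ∈ X, ‖a z * w z ^ 2 + b z‖ ≤ κ.re := by
    intro w hw z hz
    calc ‖a z * w z ^ 2 + b z‖ ≤ ‖a z‖ * ‖w z‖ ^ 2 + ‖b z‖ := by
          refine (norm_add_le _ _).trans_eq (by rw [norm_mul, norm_pow])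
      _ ≤ κ.re / 4 * 1 ^ 2 + κ.re / 2 := by
          gcongr
          exacts [ha' z hz, hw z hz, hb' z hz]
      _ ≤ κ.re := by linarith
  have hstep : ∀ w : ℂ → ℂ, DifferentiableOn ℂ w X → (∀ z ∈ X, ‖w z‖ ≤ 1) → ∀ z ∈ X,
      ‖step w z‖ ≤ 1 ∧ HasDerivAt (step w) (κ * step w z - (a z * w z ^ 2 + b z)) z := by
    intro w hw hw1 z hz
    refine ⟨(norm_forwardLaplace_le hXt hκ (hNb w hw1) hz).trans_eq (div_self hκ.ne'), ?_⟩
    exact hasDerivAt_forwardLaplace hX hXt hκ (hN w hw) (hNb w hw1) hz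
  have hcontr : ∀ (w₁ w₂ : ℂ → ℂ) (D : ℝ), DifferentiableOn ℂ w₁ X → DifferentiableOn ℂ w₂ X →
      (∀ z ∈ X, ‖w₁ z‖ ≤ 1) → (∀ z ∈ X, ‖w₂ z‖ ≤ 1) → (∀ z ∈ X, ‖w₁ z - w₂ z‖ ≤ D) →
      ∀ z ∈ X, ‖step w₁ z - step w₂ z‖ ≤ D / 2 := by
    intro w₁ w₂ D h1 h2 hb1 hb2 hD z hz
    have hsub : step w₁ z - step w₂ z =
        forwardLaplace κ (fun z => a z * (w₁ z + w₂ z) * (w₁ z - w₂ z)) z := by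
      simp only [step, forwardLaplace]
      rw [← MeasureTheory.integral_sub
        (integrable_forwardLaplace hXt hκ (hN w₁ h1).continuousOn (hNb w₁ hb1) hz)
        (integrable_forwardLaplace hXt hκ (hN w₂ h2).continuousOn (hNb w₂ hb2) hz)]
      congr 1; ext t; ring
    rw [hsub]
    refine (norm_forwardLaplace_le (M := κ.re / 4 * (1 + 1) * D) hXt hκ ?_ hz).trans_eq ?_
    · intro x hx
      rw [norm_mul, norm_mul]
      gcongr
      · exact ha' x hx
      · exact (norm_add_le _ _).trans (add_le_add (hb1 x hx) (hb2 x hx))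
      · exact hD x hx
    · field_simp; ring
  have hWprop : ∀ n, DifferentiableOn ℂ (W n) X ∧ ∀ z ∈ X, ‖W n z‖ ≤ 1 := by
    intro n
    induction n with
    | zero => exact ⟨differentiableOn_const _, fun z _ => by simp [W]⟩
    | succ n ih =>
      rw [hW]
      exact ⟨fun z hz => (hstep _ ih.1 ih.2 z hz).2.differentiableAt.differentiableWithinAt,
        fun z hz => (hstep _ ih.1 ih.2 z hz).1⟩
  have hWdiff : ∀ n, ∀ z ∈ X, ‖W (n + 1) z - W n z‖ ≤ 1 / 2 ^ n := by
    intro n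
    induction n with
    | zero =>
      intro z hz
      simpa [W] using (hWprop 1).2 z hz
    | succ n ih =>
      intro z hz
      rw [hW (n + 1)]
      nth_rw 2 [hW n]
      refine (hcontr _ _ _ (hWprop _).1 (hWprop _).1 (hWprop _).2 (hWprop _).2 ih z hz).trans_eq ?_
      rw [pow_succ]; field_simp
  have hgeom : ∀ z ∈ X, ∀ n, dist (W n z) (W (n + 1) z) ≤ 2 / 2 / 2 ^ n := by
    intro z hz n
    rw [dist_comm, dist_eq_norm]
    simpa using hWdiff n z hz
  choose! w hw using fun z (hz : z ∈ X) =>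
    cauchySeq_tendsto_of_complete (cauchySeq_of_le_geometric_two (hgeom z hz))
  have hdist : ∀ z ∈ X, ∀ n, ‖W n z - w z‖ ≤ 2 / 2 ^ n := fun z hz n => by
    rw [← dist_eq_norm]
    exact dist_le_of_le_geometric_two_of_tendsto (hgeom z hz) (hw z hz) n
  have hzero : Tendsto (fun n : ℕ => (2 : ℝ) / 2 ^ n) atTop (𝓝 0) := by
    have := (tendsto_pow_atTop_nhds_zero_of_lt_one (r := (1 / 2 : ℝ)) (by norm_num)
      (by norm_num)).const_mul 2
    simpa [div_eq_mul_inv] using this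
  have hunif : TendstoUniformlyOn W w atTop X := by
    rw [Metric.tendstoUniformlyOn_iff]
    intro ε hε
    filter_upwards [hzero.eventually (gt_mem_nhds hε)] with n hn z hz
    rw [dist_comm, dist_eq_norm]
    exact (hdist z hz n).trans_lt hn
  have hwd : DifferentiableOn ℂ w X :=
    hunif.tendstoLocallyUniformlyOn.differentiableOn
      (Eventually.of_forall fun n => (hWprop n).1) hX
  have hw1 : ∀ z ∈ X, ‖w z‖ ≤ 1 := fun z hz =>
    le_of_tendsto (hw z hz).norm (Eventually.of_forall fun n => (hWprop n).2 z hz)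
  have hfix : ∀ z ∈ X, step w z = w z := by
    intro z hz
    have h1 : Tendsto (fun n => W (n + 1) z) atTop (𝓝 (step w z)) := by
      rw [tendsto_iff_norm_sub_tendsto_zero]
      refine squeeze_zero (fun _ => norm_nonneg _) (fun n => ?_)
        (by simpa using hzero.div_const 2)
      rw [hW]
      exact hcontr _ _ _ (hWprop n).1 hwd (hWprop n).2 hw1 (fun x hx => hdist x hx n) z hz
    exact tendsto_nhds_unique h1 ((tendsto_add_atTop_iff_nat 1).2 (hw z hz))
  refine ⟨w, fun z hz => ⟨hw1 z hz, ?_⟩⟩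
  have h := (hstep w hwd hw1 z hz).2
  rw [hfix z hz] at h
  refine h.congr_of_eventuallyEq ?_
  filter_upwards [hX.mem_nhds hz] with x hx using (hfix x hx).symm

/-! ### Homogeneous coordinates on the Riemann sphere -/

/-- The point of the Riemann sphere with homogeneous coordinates `[p : q]`; the value `∞` at
`[0 : 0]` is irrelevant. -/
noncomputable def homog (p q : ℂ) : OnePoint ℂ :=
  if q = 0 then ∞ else ((p / q : ℂ) : OnePoint ℂ)

lemma homog_zero (p : ℂ) : homog p 0 = ∞ := by simp [homog]

lemma homog_of_ne {p q : ℂ} (hq : q ≠ 0) : homog p q = ((p / q : ℂ) : OnePoint ℂ) := by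
  simp [homog, hq]

lemma homog_mul_left {c : ℂ} (hc : c ≠ 0) (p q : ℂ) : homog (c * p) (c * q) = homog p q := by
  by_cases hq : q = 0
  · simp [hq, homog_zero]
  · rw [homog_of_ne hq, homog_of_ne (mul_ne_zero hc hq), mul_div_mul_left _ _ hc]

lemma homog_ne_homog {p q p' q' : ℂ} (h : p * q' - p' * q ≠ 0) : homog p q ≠ homog p' q' := by
  by_cases hq : q = 0 <;> by_cases hq' : q' = 0
  · exact absurd (by simp [hq, hq']) h
  · simp [hq, homog_zero, homog_of_ne hq']
  · simp [hq', homog_zero, homog_of_ne hq]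
  · rw [homog_of_ne hq, homog_of_ne hq', Ne, OnePoint.coe_eq_coe, div_eq_div_iff hq hq']
    exact fun h' => h (by linear_combination h')

lemma tendsto_nhds_infty_of_norm {ι : Type*} {l : Filter ι} {F : ι → OnePoint ℂ}
    (h : ∀ R : ℝ, ∀ᶠ i in l, ∀ u : ℂ, F i = u → R < ‖u‖) : Tendsto F l (𝓝 ∞) := by
  rw [OnePoint.hasBasis_nhds_infty (X := ℂ) |>.tendsto_right_iff]
  rintro s ⟨-, hs⟩
  obtain ⟨R, hR⟩ := hs.isBounded.exists_norm_le
  filter_upwards [h R] with i hi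
  rcases hFi : F i with _ | u
  · exact Or.inr rfl
  · exact Or.inl ⟨u, fun hu => absurd (hi u hFi) (not_lt.2 (hR u hu)), rfl⟩

lemma tendsto_homog {ι : Type*} {l : Filter ι} {p q : ι → ℂ} {p₀ q₀ : ℂ}
    (hp : Tendsto p l (𝓝 p₀)) (hq : Tendsto q l (𝓝 q₀)) (h : p₀ ≠ 0 ∨ q₀ ≠ 0) :
    Tendsto (fun i => homog (p i) (q i)) l (𝓝 (homog p₀ q₀)) := by
  by_cases hq₀ : q₀ = 0
  · have hp₀ : p₀ ≠ 0 := h.resolve_right (not_not.2 hq₀)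
    subst hq₀
    rw [homog_zero]
    refine tendsto_nhds_infty_of_norm fun R => ?_
    have hlim : Tendsto (fun i => ‖p i‖ - R * ‖q i‖) l (𝓝 (‖p₀‖ - R * ‖(0 : ℂ)‖)) :=
      hp.norm.sub (hq.norm.const_mul R)
    have hpos : 0 < ‖p₀‖ - R * ‖(0 : ℂ)‖ := by simpa using hp₀
    filter_upwards [hlim.eventually (lt_mem_nhds hpos)] with i hi u hu
    by_cases hqi : q i = 0
    · rw [hqi, homog_zero] at hu
      exact absurd hu (OnePoint.infty_ne_coe u)
    · rw [homog_of_ne hqi, OnePoint.coe_eq_coe] at hu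
      rw [← hu, norm_div, lt_div_iff₀ (norm_pos_iff.2 hqi)]
      linarith
  · rw [homog_of_ne hq₀]
    have hlim := (OnePoint.continuous_coe.tendsto (p₀ / q₀)).comp (hp.div hq hq₀)
    refine hlim.congr' ?_
    filter_upwards [hq.eventually_ne hq₀] with i hi
    simp [homog_of_ne hi]

/-- The chordal distance in homogeneous coordinates. -/
lemma chordalDist_homog {p q p' q' : ℂ} (h : p ≠ 0 ∨ q ≠ 0) (h' : p' ≠ 0 ∨ q' ≠ 0) :
    chordalDist (homog p q) (homog p' q') =
      2 * ‖p * q' - p' * q‖ / (√(‖p‖ ^ 2 + ‖q‖ ^ 2) * √(‖p'‖ ^ 2 + ‖q'‖ ^ 2)) := by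
  have hs : ∀ {x y : ℂ}, y ≠ 0 → √(1 + ‖x / y‖ ^ 2) = √(‖x‖ ^ 2 + ‖y‖ ^ 2) / ‖y‖ := by
    intro x y hy
    have hy' : ‖y‖ ≠ 0 := norm_ne_zero_iff.2 hy
    rw [Real.sqrt_eq_iff_mul_self_eq (by positivity) (by positivity), norm_div]
    field_simp
    rw [Real.sq_sqrt (by positivity)]
    ring
  have hpos : ∀ {x y : ℂ}, x ≠ 0 ∨ y ≠ 0 → √(‖x‖ ^ 2 + ‖y‖ ^ 2) ≠ 0 := by
    intro x y hxy
    refine (Real.sqrt_pos.2 ?_).ne'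
    rcases hxy with hx | hy
    · have := norm_pos_iff.2 hx; positivity
    · have := norm_pos_iff.2 hy; positivity
  have h1 := hpos h
  have h2 := hpos h'
  by_cases hq : q = 0 <;> by_cases hq' : q' = 0
  · subst hq hq'
    simp only [homog_zero]
    simp [chordalDist]
  · subst hq
    have hp : ‖p‖ ≠ 0 := by simpa using h
    rw [homog_zero, homog_of_ne hq']
    change 2 / √(1 + ‖p' / q'‖ ^ 2) = _
    rw [hs hq']
    simp only [norm_zero, mul_zero, sub_zero, norm_mul, ne_eq, OfNat.ofNat_ne_zero,
      not_false_eq_true, zero_pow, add_zero, Real.sqrt_sq (norm_nonneg p)]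
    field_simp
  · subst hq'
    have hp : ‖p'‖ ≠ 0 := by simpa using h'
    rw [homog_zero, homog_of_ne hq]
    change 2 / √(1 + ‖p / q‖ ^ 2) = _
    rw [hs hq]
    simp only [norm_zero, mul_zero, zero_sub, norm_neg, norm_mul, ne_eq, OfNat.ofNat_ne_zero,
      not_false_eq_true, zero_pow, add_zero, Real.sqrt_sq (norm_nonneg p')]
    field_simp
  · rw [homog_of_ne hq, homog_of_ne hq']
    change 2 * ‖p / q - p' / q'‖ / (√(1 + ‖p / q‖ ^ 2) * √(1 + ‖p' / q'‖ ^ 2)) = _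
    have hn : ‖q‖ ≠ 0 := norm_ne_zero_iff.2 hq
    have hn' : ‖q'‖ ≠ 0 := norm_ne_zero_iff.2 hq'
    rw [hs hq, hs hq', div_sub_div _ _ hq hq', norm_div, norm_mul, mul_comm q p']
    field_simp

lemma continuous_GL_smul (g : GL (Fin 2) ℂ) : Continuous fun x : OnePoint ℂ => g • x := by
  have hdet : g 0 0 * g 1 1 - g 0 1 * g 1 0 ≠ 0 := by
    have := g.det_ne_zero
    rwa [Matrix.det_fin_two] at this
  have hne : ∀ p q : ℂ, p ≠ 0 ∨ q ≠ 0 →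
      g 0 0 * p + g 0 1 * q ≠ 0 ∨ g 1 0 * p + g 1 1 * q ≠ 0 := by
    intro p q hpq
    by_contra! hcon
    obtain ⟨h1, h2⟩ := hcon
    have hp : (g 0 0 * g 1 1 - g 0 1 * g 1 0) * p = 0 := by
      linear_combination g 1 1 * h1 - g 0 1 * h2
    have hq : (g 0 0 * g 1 1 - g 0 1 * g 1 0) * q = 0 := by
      linear_combination g 0 0 * h2 - g 1 0 * h1
    rcases hpq with h | h
    · exact mul_ne_zero hdet h hp
    · exact mul_ne_zero hdet h hq
  have hcoe : ∀ u : ℂ, g • (u : OnePoint ℂ) =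
      homog (g 0 0 * u + g 0 1 * 1) (g 1 0 * u + g 1 1 * 1) := by
    intro u
    rw [OnePoint.smul_some_eq_ite, homog]
    simp
  have hinf : g • (∞ : OnePoint ℂ) = homog (g 0 0 * 1 + g 0 1 * 0) (g 1 0 * 1 + g 1 1 * 0) := by
    rw [OnePoint.smul_infty_eq_ite, homog]
    simp
  rw [continuous_iff_continuousAt]
  intro x
  rcases x with _ | u
  · change ContinuousAt (fun x : OnePoint ℂ => g • x) ∞
    rw [OnePoint.continuousAt_infty', coclosedCompact_eq_cocompact, ← Metric.cobounded_eq_cocompact]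
    have hinv : Tendsto (fun u : ℂ => u⁻¹) (Bornology.cobounded ℂ) (𝓝 0) :=
      tendsto_inv₀_cobounded
    rw [hinf]
    refine (tendsto_homog (p := fun u : ℂ => g 0 0 * 1 + g 0 1 * u⁻¹)
      (q := fun u : ℂ => g 1 0 * 1 + g 1 1 * u⁻¹) (tendsto_const_nhds.add (hinv.const_mul _))
      (tendsto_const_nhds.add (hinv.const_mul _)) (hne 1 0 (Or.inl one_ne_zero))).congr' ?_
    filter_upwards [Bornology.eventually_ne_cobounded (0 : ℂ)] with u hu
    rw [Function.comp_apply, hcoe, ← homog_mul_left hu]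
    congr 1 <;> field_simp
  · change ContinuousAt (fun x : OnePoint ℂ => g • x) (u : OnePoint ℂ)
    rw [OnePoint.continuousAt_coe]
    unfold ContinuousAt
    rw [Function.comp_apply, hcoe]
    refine (tendsto_homog (p := fun u : ℂ => g 0 0 * u + g 0 1 * 1)
      (q := fun u : ℂ => g 1 0 * u + g 1 1 * 1) ?_ ?_ (hne u 1 (Or.inr one_ne_zero))).congr ?_
    · exact Continuous.tendsto (by fun_prop) u
    · exact Continuous.tendsto (by fun_prop) u
    · exact fun v => (hcoe v).symm

/-! ### Solutions of the Schwarzian equation as quotients of linear solutions -/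

/-- The Wronskian of two solutions of `φ'' = Q φ` is constant. -/
lemma exists_wronskian_eq {Q φ ψ h k : ℂ → ℂ} {U : Set ℂ} (hU : IsOpen U) (hUc : IsPreconnected U)
    (hφ : ∀ z ∈ U, HasDerivAt φ (ψ z) z) (hψ : ∀ z ∈ U, HasDerivAt ψ (Q z * φ z) z)
    (hh : ∀ z ∈ U, HasDerivAt h (k z) z) (hk : ∀ z ∈ U, HasDerivAt k (Q z * h z) z) :
    ∃ A : ℂ, ∀ z ∈ U, h z * ψ z - k z * φ z = A := by
  have hd : ∀ z ∈ U, HasDerivAt (fun z => h z * ψ z - k z * φ z) 0 z := fun z hz =>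
    (((hh z hz).mul (hψ z hz)).sub ((hk z hz).mul (hφ z hz))).congr_deriv (by ring)
  exact hU.exists_is_const_of_deriv_eq_zero hUc
    (fun z hz => (hd z hz).differentiableAt.differentiableWithinAt) (fun z hz => (hd z hz).deriv)

/-- Near a point where `F` is analytic with nonzero derivative, `F` is the quotient of the two
solutions `F h` and `h` of `φ'' = Q φ`, where `h` is a branch of `(F')^{-1/2}`. Hence it is a
quotient of linear combinations of any two independent solutions. -/
lemma exists_local_quotient {F Q φ₁ ψ₁ φ₂ ψ₂ : ℂ → ℂ} {z₀ : ℂ} {ρ : ℝ} (hρ : 0 < ρ)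
    (hF : ∀ z ∈ Metric.ball z₀ ρ, AnalyticAt ℂ F z)
    (hF' : ∀ z ∈ Metric.ball z₀ ρ, deriv F z ≠ 0)
    (hS : ∀ z ∈ Metric.ball z₀ ρ, schwarzian F z = -2 * Q z)
    (hφ₁ : ∀ z ∈ Metric.ball z₀ ρ, HasDerivAt φ₁ (ψ₁ z) z)
    (hψ₁ : ∀ z ∈ Metric.ball z₀ ρ, HasDerivAt ψ₁ (Q z * φ₁ z) z)
    (hφ₂ : ∀ z ∈ Metric.ball z₀ ρ, HasDerivAt φ₂ (ψ₂ z) z)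
    (hψ₂ : ∀ z ∈ Metric.ball z₀ ρ, HasDerivAt ψ₂ (Q z * φ₂ z) z)
    (hW : φ₁ z₀ * ψ₂ z₀ - ψ₁ z₀ * φ₂ z₀ ≠ 0) :
    ∃ α β γ δ : ℂ, α * δ - β * γ ≠ 0 ∧ ∀ z ∈ Metric.ball z₀ ρ,
      F z * (γ * φ₁ z + δ * φ₂ z) = α * φ₁ z + β * φ₂ z := by
  have hd1 : ∀ z ∈ Metric.ball z₀ ρ, HasDerivAt F (deriv F z) z := fun z hz =>
    (hF z hz).differentiableAt.hasDerivAt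
  have hd2 : ∀ z ∈ Metric.ball z₀ ρ, HasDerivAt (deriv F) (iteratedDeriv 2 F z) z := by
    intro z hz
    rw [iteratedDeriv_succ, iteratedDeriv_one]
    exact (hF z hz).deriv.differentiableAt.hasDerivAt
  have hd3 : ∀ z ∈ Metric.ball z₀ ρ,
      HasDerivAt (iteratedDeriv 2 F) (iteratedDeriv 3 F z) z := by
    intro z hz
    rw [iteratedDeriv_succ (n := 2)]
    refine DifferentiableAt.hasDerivAt ?_
    rw [iteratedDeriv_succ, iteratedDeriv_one]
    exact (hF z hz).deriv.deriv.differentiableAt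
  -- `v` is the logarithmic derivative of `h = (F')^{-1/2}`
  set v : ℂ → ℂ := fun z => -(1 / 2) * (iteratedDeriv 2 F z / deriv F z) with hv
  have hvd : ∀ z ∈ Metric.ball z₀ ρ, HasDerivAt v (Q z - v z ^ 2) z := by
    intro z hz
    refine (((hd3 z hz).div (hd2 z hz) (hF' z hz)).const_mul (-(1 / 2) : ℂ)).congr_deriv ?_
    have h1 := hS z hz
    have h2 := hF' z hz
    simp only [schwarzian] at h1
    have h3 : Q z = -(1 / 2) * (iteratedDeriv 3 F z / deriv F z -
        3 / 2 * (iteratedDeriv 2 F z / deriv F z) ^ 2) := by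
      rw [h1]; ring
    rw [h3, hv]
    field_simp
    ring
  obtain ⟨ℓ, hℓ⟩ := (convex_ball z₀ ρ).exists_forall_hasDerivWithinAt (𝕜 := ℂ)
    (f := v) (fun z hz => (hvd z hz).differentiableAt.differentiableWithinAt)
  have hℓ' : ∀ z ∈ Metric.ball z₀ ρ, HasDerivAt ℓ (v z) z := fun z hz =>
    (hℓ z hz).hasDerivAt (Metric.isOpen_ball.mem_nhds hz)
  set h : ℂ → ℂ := fun z => Complex.exp (ℓ z) with hh
  have hhd : ∀ z ∈ Metric.ball z₀ ρ, HasDerivAt h (v z * h z) z := fun z hz =>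
    (hℓ' z hz).cexp.congr_deriv (mul_comm _ _)
  have hkd : ∀ z ∈ Metric.ball z₀ ρ, HasDerivAt (fun z => v z * h z) (Q z * h z) z := fun z hz =>
    ((hvd z hz).mul (hhd z hz)).congr_deriv (by ring)
  have hHd : ∀ z ∈ Metric.ball z₀ ρ,
      HasDerivAt (fun z => F z * h z) (deriv F z * h z + F z * (v z * h z)) z := fun z hz =>
    (hd1 z hz).mul (hhd z hz)
  have hKd : ∀ z ∈ Metric.ball z₀ ρ,
      HasDerivAt (fun z => deriv F z * h z + F z * (v z * h z)) (Q z * (F z * h z)) z := by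
    intro z hz
    refine (((hd2 z hz).mul (hhd z hz)).add ((hd1 z hz).mul (hkd z hz))).congr_deriv ?_
    have h2 := hF' z hz
    simp only [hv]
    field_simp
    ring
  have hc := (convex_ball z₀ ρ).isPreconnected
  obtain ⟨A₁, hA₁⟩ := exists_wronskian_eq Metric.isOpen_ball hc hφ₁ hψ₁ hhd hkd
  obtain ⟨A₂, hA₂⟩ := exists_wronskian_eq Metric.isOpen_ball hc hφ₂ hψ₂ hhd hkd
  obtain ⟨B₁, hB₁⟩ := exists_wronskian_eq Metric.isOpen_ball hc hφ₁ hψ₁ hHd hKd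
  obtain ⟨B₂, hB₂⟩ := exists_wronskian_eq Metric.isOpen_ball hc hφ₂ hψ₂ hHd hKd
  refine ⟨B₂, -B₁, A₂, -A₁, ?_, fun z hz => ?_⟩
  · have hz₀ := Metric.mem_ball_self (x := z₀) hρ
    have hprod : B₂ * -A₁ - -B₁ * A₂ =
        -((φ₁ z₀ * ψ₂ z₀ - ψ₁ z₀ * φ₂ z₀) * (h z₀ ^ 2 * deriv F z₀)) := by
      rw [← hA₁ z₀ hz₀, ← hA₂ z₀ hz₀, ← hB₁ z₀ hz₀, ← hB₂ z₀ hz₀]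
      ring
    rw [hprod]
    exact neg_ne_zero.2 (mul_ne_zero hW (mul_ne_zero (pow_ne_zero _ (Complex.exp_ne_zero _))
      (hF' z₀ hz₀)))
  · rw [← hA₁ z hz, ← hA₂ z hz, ← hB₁ z hz, ← hB₂ z hz]
    ring

/-- A solution `f` of the Schwarzian equation is, on a domain where `Q` has no zeros, a Möbius
transformation of the quotient of any two independent solutions of `φ'' = Q φ`. -/
lemma exists_eq_homog {F Q φ₁ ψ₁ φ₂ ψ₂ : ℂ → ℂ} {f : ℂ → OnePoint ℂ} {E : Set ℂ}
    (hF : Meromorphic F)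
    (hf : ∀ l : ℂ, Tendsto (fun x : ℂ => (F x : OnePoint ℂ)) (𝓝[≠] l) (𝓝 (f l)))
    (hS : ∀ᶠ l in codiscrete ℂ, schwarzian F l = -2 * Q l)
    (hE : IsOpen E) (hEc : IsConnected E) (hQ : ∀ z ∈ E, Q z ≠ 0)
    (hφ₁ : ∀ z ∈ E, HasDerivAt φ₁ (ψ₁ z) z) (hψ₁ : ∀ z ∈ E, HasDerivAt ψ₁ (Q z * φ₁ z) z)
    (hφ₂ : ∀ z ∈ E, HasDerivAt φ₂ (ψ₂ z) z) (hψ₂ : ∀ z ∈ E, HasDerivAt ψ₂ (Q z * φ₂ z) z)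
    (hφ₁0 : ∀ z ∈ E, φ₁ z ≠ 0) (hW : ∀ z ∈ E, φ₁ z * ψ₂ z - ψ₁ z * φ₂ z ≠ 0) :
    ∃ α β γ δ : ℂ, α * δ - β * γ ≠ 0 ∧ ∀ z ∈ E,
      f z = homog (α * φ₁ z + β * φ₂ z) (γ * φ₁ z + δ * φ₂ z) := by
  obtain ⟨x, hx⟩ := hEc.nonempty
  -- a point of `E` near which the equation holds and `F` is analytic
  have hev : ∀ᶠ z in 𝓝[≠] x, z ∈ E ∧ AnalyticAt ℂ F z ∧ schwarzian F z = -2 * Q z := by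
    have h1 : ∀ᶠ z in 𝓝[≠] x, z ∈ E := mem_nhdsWithin_of_mem_nhds (hE.mem_nhds hx)
    have h2 : ∀ᶠ z in 𝓝[≠] x, schwarzian F z = -2 * Q z :=
      Filter.mem_of_superset (mem_codiscreteWithin_iff_forall_mem_nhdsNE.1 hS x (mem_univ x))
        fun z hz => by simpa using hz
    exact h1.and ((hF x).eventually_analyticAt.and h2)
  obtain ⟨z₀, hz₀⟩ := (eventually_eventually_nhdsWithin.2 hev |>.and
    eventually_mem_nhdsWithin).exists
  have hev₀ : ∀ᶠ z in 𝓝 z₀, z ∈ E ∧ AnalyticAt ℂ F z ∧ schwarzian F z = -2 * Q z := by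
    have h1 := hz₀.1
    rwa [isOpen_compl_singleton.nhdsWithin_eq hz₀.2] at h1
  obtain ⟨ρ, hρ, hball⟩ := Metric.eventually_nhds_iff_ball.1 hev₀
  have hz₀E : z₀ ∈ E := (hball z₀ (Metric.mem_ball_self hρ)).1
  have hF' : ∀ z ∈ Metric.ball z₀ ρ, deriv F z ≠ 0 := by
    intro z hz h0
    -- at a zero of `F'` the Schwarzian has the junk value `0` (division by zero), but `Q ≠ 0` on `E`
    have h1 := (hball z hz).2.2
    simp only [schwarzian, h0, div_zero] at h1
    exact hQ z (hball z hz).1 (by linear_combination (1 / 2 : ℂ) * h1)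
  obtain ⟨α, β, γ, δ, hdet, hloc⟩ := exists_local_quotient hρ (fun z hz => (hball z hz).2.1) hF'
    (fun z hz => (hball z hz).2.2) (fun z hz => hφ₁ z (hball z hz).1)
    (fun z hz => hψ₁ z (hball z hz).1) (fun z hz => hφ₂ z (hball z hz).1)
    (fun z hz => hψ₂ z (hball z hz).1) (hW z₀ hz₀E)
  refine ⟨α, β, γ, δ, hdet, fun z hz => ?_⟩
  have hne : ∀ y ∈ E, α * φ₁ y + β * φ₂ y ≠ 0 ∨ γ * φ₁ y + δ * φ₂ y ≠ 0 := by
    intro y hy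
    by_contra! hcon
    obtain ⟨h1, h2⟩ := hcon
    exact mul_ne_zero hdet (hφ₁0 y hy) (by linear_combination δ * h1 - β * h2)
  -- as a meromorphic identity, `F (γ φ₁ + δ φ₂) = α φ₁ + β φ₂` propagates from `z₀` to `E`
  set G : ℂ → ℂ := fun z => F z * (γ * φ₁ z + δ * φ₂ z) - (α * φ₁ z + β * φ₂ z) with hG
  have han : ∀ {φ ψ : ℂ → ℂ}, (∀ z ∈ E, HasDerivAt φ (ψ z) z) → ∀ z ∈ E, AnalyticAt ℂ φ z :=
    fun hφ z hz => DifferentiableOn.analyticAt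
      (fun y hy => (hφ y hy).differentiableAt.differentiableWithinAt) (hE.mem_nhds hz)
  have hGm : MeromorphicOn G E := by
    intro y hy
    have h1 := (han hφ₁ y hy).meromorphicAt
    have h2 := (han hφ₂ y hy).meromorphicAt
    exact ((hF y).mul
      (((MeromorphicAt.const γ y).mul h1).add ((MeromorphicAt.const δ y).mul h2))).sub
      (((MeromorphicAt.const α y).mul h1).add ((MeromorphicAt.const β y).mul h2))
  have hGz : ∀ᶠ y in 𝓝[≠] z, G y = 0 := by
    rw [← meromorphicOrderAt_eq_top_iff]
    by_contra hne'
    refine hGm.meromorphicOrderAt_ne_top_of_isPreconnected hEc.isPreconnected hz hz₀E hne' ?_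
    rw [meromorphicOrderAt_eq_top_iff]
    refine mem_nhdsWithin_of_mem_nhds ?_
    filter_upwards [Metric.ball_mem_nhds z₀ hρ] with y hy
    simp [hG, hloc y hy]
  have hFeq : ∀ᶠ y in 𝓝[≠] z,
      homog (α * φ₁ y + β * φ₂ y) (γ * φ₁ y + δ * φ₂ y) = (F y : OnePoint ℂ) := by
    filter_upwards [hGz, mem_nhdsWithin_of_mem_nhds (hE.mem_nhds hz)] with y hy hyE
    have h1 : F y * (γ * φ₁ y + δ * φ₂ y) = α * φ₁ y + β * φ₂ y := sub_eq_zero.1 hy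
    have h2 : γ * φ₁ y + δ * φ₂ y ≠ 0 := by
      intro h0
      rcases hne y hyE with h | h
      · exact h (by rw [← h1, h0, mul_zero])
      · exact h h0
    rw [homog_of_ne h2, ← h1, mul_div_cancel_right₀ _ h2]
  have c1 := (hφ₁ z hz).continuousAt
  have c2 := (hφ₂ z hz).continuousAt
  have hlim : Tendsto (fun y => homog (α * φ₁ y + β * φ₂ y) (γ * φ₁ y + δ * φ₂ y)) (𝓝[≠] z)
      (𝓝 (homog (α * φ₁ z + β * φ₂ z) (γ * φ₁ z + δ * φ₂ z))) :=
    (tendsto_homog ((c1.tendsto.const_mul α).add (c2.tendsto.const_mul β))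
      ((c1.tendsto.const_mul γ).add (c2.tendsto.const_mul δ)) (hne z hz)).mono_left
      nhdsWithin_le_nhds
  exact tendsto_nhds_unique (hf z) (hlim.congr' hFeq)

/-! ### Riccati solutions on sectors -/

/-- In polar coordinates: `|y| ≤ Re y + 8 |Im y|` in the sector `|arg y| ≤ 7π/8`, the image of the
sector `|arg ν| ≤ 7π/20` under `ν ↦ ν^{5/2}`. -/
lemma one_le_cos_add_abs_sin {θ : ℝ} (h : |θ| ≤ 7 * Real.pi / 8) :
    1 ≤ Real.cos θ + 8 * |Real.sin θ| := by
  have key : ∀ φ : ℝ, 0 ≤ φ → φ ≤ 7 * Real.pi / 8 → 1 ≤ Real.cos φ + 8 * Real.sin φ := by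
    intro φ h0 h1
    have hpi := Real.pi_pos
    rcases le_or_gt φ (Real.pi / 8) with h2 | h2
    · have hc : 0 ≤ Real.cos φ := Real.cos_nonneg_of_mem_Icc ⟨by linarith, by linarith⟩
      have hs : 0 ≤ Real.sin φ := Real.sin_nonneg_of_nonneg_of_le_pi h0 (by linarith)
      nlinarith [Real.sin_sq_add_cos_sq φ, mul_nonneg hc hs]
    · have hs : 1 / 4 ≤ Real.sin φ := by
        have hJ : ∀ x, Real.pi / 8 ≤ x → x ≤ Real.pi / 2 → 1 / 4 ≤ Real.sin x := by
          intro x hx hx'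
          refine le_trans ?_ (Real.mul_le_sin (by linarith) hx')
          rw [div_mul_eq_mul_div, le_div_iff₀ hpi]
          linarith
        rcases le_or_gt φ (Real.pi / 2) with h3 | h3
        · exact hJ φ h2.le h3
        · rw [← Real.sin_pi_sub]
          exact hJ _ (by linarith) (by linarith)
      linarith [Real.neg_one_le_cos φ]
  have habs := key |θ| (abs_nonneg θ) h
  rw [Real.cos_abs] at habs
  refine habs.trans ?_
  gcongr
  rcases abs_cases θ with ⟨h1, -⟩ | ⟨h1, -⟩ <;> rw [h1]
  · exact le_abs_self _
  · rw [Real.sin_neg]; exact neg_le_abs _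

lemma norm_cpow_of_im_eq_zero {z : ℂ} (hz : z ≠ 0) {w : ℂ} (hw : w.im = 0) :
    ‖z ^ w‖ = ‖z‖ ^ w.re := by
  rw [Complex.norm_cpow_of_ne_zero hz, hw]; simp

lemma re_im_cpow_five_halves {z : ℂ} (hz : z ≠ 0) :
    (z ^ (5 / 2 : ℂ)).re = ‖z‖ ^ (5 / 2 : ℝ) * Real.cos (5 / 2 * z.arg) ∧
      (z ^ (5 / 2 : ℂ)).im = ‖z‖ ^ (5 / 2 : ℝ) * Real.sin (5 / 2 * z.arg) := by
  have h1 : (Complex.log z * (5 / 2 : ℂ)).re = Real.log ‖z‖ * (5 / 2) := by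
    simp [Complex.mul_re, Complex.log_re]
  have h2 : (Complex.log z * (5 / 2 : ℂ)).im = 5 / 2 * z.arg := by
    simp [Complex.mul_im, Complex.log_im, mul_comm]
  rw [Complex.cpow_def_of_ne_zero hz, Real.rpow_def_of_pos (norm_pos_iff.2 hz), Complex.exp_re,
    Complex.exp_im, h1, h2]
  exact ⟨rfl, rfl⟩

/-- For `Q ~ s² ν³` with `Re s > 0`, the equation `v' = Q - v²` has a solution
`v = -s ν^{3/2} + O(1)` in the sector `|arg ν| ≤ 7π/20`. In the variable `y = ν^{5/2}` the
remainder `w` satisfies `w' = (4/5) s w - (a w² + b)` with coefficients tending to `0`, on a domain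
invariant under translation by positive reals that contains the image of the sector. -/
lemma exists_riccati_model {Q : ℂ → ℂ} {K R₀ : ℝ} {s : ℂ}
    (hQd : ∀ ν : ℂ, R₀ ≤ ‖ν‖ → DifferentiableAt ℂ Q ν)
    (hQ : ∀ ν : ℂ, R₀ ≤ ‖ν‖ → ‖Q ν - s ^ 2 * ν ^ 3‖ ≤ K * ‖ν‖) (hs : 0 < s.re) :
    ∃ (R : ℝ) (v : ℂ → ℂ), ∀ ν : ℂ, |ν.arg| ≤ 7 * Real.pi / 20 → R ≤ ‖ν‖ →
      HasDerivAt v (Q ν - v ν ^ 2) ν ∧ ‖v ν + s * ν ^ (3 / 2 : ℂ)‖ ≤ 1 := by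
  have hpi := Real.pi_pos
  set η : ℝ := s.re / (5 * (|K| + ‖s‖ + 1)) with hη
  have hden : 0 < |K| + ‖s‖ + 1 := by positivity
  have hη0 : 0 < η := by positivity
  have hηK : (|K| + ‖s‖ + 1) * η = s.re / 5 := by rw [hη]; field_simp
  have hev : ∀ᶠ Y : ℝ in atTop, 1 ≤ Y ∧ R₀ ≤ Y ^ (2 / 5 : ℝ) ∧ Y ^ (-(1 / 5) : ℝ) ≤ η := by
    refine (eventually_ge_atTop 1).and (((tendsto_rpow_atTop (by norm_num)).eventually_ge_atTop
      R₀).and ?_)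
    exact ((tendsto_rpow_neg_atTop (y := 1 / 5) (by norm_num)).eventually (gt_mem_nhds hη0)).mono
      fun Y hY => hY.le
  obtain ⟨Y₀, hY₀⟩ := eventually_atTop.1 hev
  set ρ : ℝ := 9 * max Y₀ 1 with hρ
  have hρ0 : 0 < ρ := by positivity
  -- a translation-invariant domain avoiding the cut of the powers and the disc of radius `Y₀`
  set X : Set ℂ := {y : ℂ | ρ < y.re + 8 * |y.im|} with hXdef
  have hX : IsOpen X := isOpen_lt continuous_const (by fun_prop)
  have hXt : ∀ z ∈ X, ∀ t : ℝ, 0 ≤ t → z + t ∈ X := by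
    intro z hz t ht
    simp only [hXdef, mem_ofPred_eq, Complex.add_re, Complex.add_im, Complex.ofReal_re,
      Complex.ofReal_im, add_zero] at hz ⊢
    linarith
  have hXslit : ∀ y ∈ X, y ∈ Complex.slitPlane := by
    intro y hy
    rw [Complex.mem_slitPlane_iff]
    by_contra! hcon
    simp only [hXdef, mem_ofPred_eq, hcon.2, abs_zero] at hy
    linarith [hcon.1]
  have hXnorm : ∀ y ∈ X, Y₀ ≤ ‖y‖ := by
    intro y hy
    have h1 : ρ < y.re + 8 * |y.im| := hy
    have h2 := (le_abs_self y.re).trans (Complex.abs_re_le_norm y)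
    have h3 := Complex.abs_im_le_norm y
    have h4 := le_max_left Y₀ 1
    linarith
  -- the coefficients of the equation for the remainder
  set a : ℂ → ℂ := fun y => 2 / 5 * y ^ (-(3 / 5) : ℂ) with ha
  set g : ℂ → ℂ := fun y => Q (y ^ (2 / 5 : ℂ)) - s ^ 2 * (y ^ (2 / 5 : ℂ)) ^ 3 +
    3 / 2 * s * y ^ (1 / 5 : ℂ) with hg
  have hpow : ∀ c : ℂ, DifferentiableOn ℂ (fun y : ℂ => y ^ c) X := fun c y hy =>
    (differentiableAt_id.cpow_const (hXslit y hy)).differentiableWithinAt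
  have hbase : ∀ y ∈ X, R₀ ≤ ‖y ^ (2 / 5 : ℂ)‖ := by
    intro y hy
    rw [norm_cpow_of_im_eq_zero (Complex.slitPlane_ne_zero (hXslit y hy)) (by norm_num)]
    convert (hY₀ ‖y‖ (hXnorm y hy)).2.1 using 2
    norm_num
  have had : DifferentiableOn ℂ a X := (hpow _).const_mul _
  have hgd : DifferentiableOn ℂ g X := by
    refine DifferentiableOn.add (DifferentiableOn.sub ?_ ?_) ((hpow _).const_mul _)
    · intro y hy
      exact ((hQd _ (hbase y hy)).comp y
        (differentiableAt_id.cpow_const (hXslit y hy))).differentiableWithinAt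
    · exact ((hpow _).pow 3).const_mul _
  have hanorm : ∀ y ∈ X, ‖a y‖ = 2 / 5 * ‖y‖ ^ (-(3 / 5) : ℝ) := by
    intro y hy
    rw [ha]
    simp only [norm_mul]
    rw [norm_cpow_of_im_eq_zero (Complex.slitPlane_ne_zero (hXslit y hy)) (by norm_num)]
    norm_num
  have hgnorm : ∀ y ∈ X, ‖g y‖ ≤ |K| * ‖y‖ ^ (2 / 5 : ℝ) + 3 / 2 * ‖s‖ * ‖y‖ ^ (1 / 5 : ℝ) := by
    intro y hy
    have hy0 := Complex.slitPlane_ne_zero (hXslit y hy)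
    have h1 := hQ _ (hbase y hy)
    have e1 : ‖y ^ (2 / 5 : ℂ)‖ = ‖y‖ ^ (2 / 5 : ℝ) := by
      rw [norm_cpow_of_im_eq_zero hy0 (by norm_num)]; norm_num
    have e2 : ‖y ^ (1 / 5 : ℂ)‖ = ‖y‖ ^ (1 / 5 : ℝ) := by
      rw [norm_cpow_of_im_eq_zero hy0 (by norm_num)]; norm_num
    refine (norm_add_le _ _).trans (add_le_add ?_ ?_)
    · rw [e1] at h1
      refine h1.trans ?_
      gcongr
      exact le_abs_self K
    · rw [norm_mul, norm_mul, e2]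
      norm_num
  have hsmall : ∀ y ∈ X, 1 ≤ ‖y‖ ∧ ‖y‖ ^ (-(1 / 5) : ℝ) ≤ η := fun y hy =>
    ⟨(hY₀ _ (hXnorm y hy)).1, (hY₀ _ (hXnorm y hy)).2.2⟩
  have hκ : (4 / 5 * s).re = 4 / 5 * s.re := by
    simp [Complex.mul_re]
  have ha' : ∀ y ∈ X, ‖a y‖ ≤ (4 / 5 * s).re / 4 := by
    intro y hy
    obtain ⟨h1, h2⟩ := hsmall y hy
    have h3 : ‖y‖ ^ (-(3 / 5) : ℝ) ≤ ‖y‖ ^ (-(1 / 5) : ℝ) :=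
      Real.rpow_le_rpow_of_exponent_le h1 (by norm_num)
    rw [hanorm y hy, hκ]
    have h4 : η ≤ s.re / 5 := by
      rw [← hηK]
      exact le_mul_of_one_le_left hη0.le (by linarith [abs_nonneg K, norm_nonneg s])
    linarith [Real.rpow_nonneg (norm_nonneg y) (-(3 / 5) : ℝ)]
  have hb' : ∀ y ∈ X, ‖-(a y * g y)‖ ≤ (4 / 5 * s).re / 2 := by
    intro y hy
    obtain ⟨h1, h2⟩ := hsmall y hy
    have hypos : 0 < ‖y‖ := by linarith
    have e1 : ‖y‖ ^ (-(3 / 5) : ℝ) * ‖y‖ ^ (2 / 5 : ℝ) = ‖y‖ ^ (-(1 / 5) : ℝ) := by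
      rw [← Real.rpow_add hypos]; norm_num
    have e2 : ‖y‖ ^ (-(3 / 5) : ℝ) * ‖y‖ ^ (1 / 5 : ℝ) ≤ ‖y‖ ^ (-(1 / 5) : ℝ) := by
      rw [← Real.rpow_add hypos]
      exact Real.rpow_le_rpow_of_exponent_le h1 (by norm_num)
    rw [norm_neg, norm_mul, hanorm y hy, hκ]
    calc 2 / 5 * ‖y‖ ^ (-(3 / 5) : ℝ) * ‖g y‖
        ≤ 2 / 5 * ‖y‖ ^ (-(3 / 5) : ℝ) *
          (|K| * ‖y‖ ^ (2 / 5 : ℝ) + 3 / 2 * ‖s‖ * ‖y‖ ^ (1 / 5 : ℝ)) := by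
          gcongr; exact hgnorm y hy
      _ = 2 / 5 * |K| * (‖y‖ ^ (-(3 / 5) : ℝ) * ‖y‖ ^ (2 / 5 : ℝ)) +
          3 / 5 * ‖s‖ * (‖y‖ ^ (-(3 / 5) : ℝ) * ‖y‖ ^ (1 / 5 : ℝ)) := by ring
      _ ≤ 2 / 5 * |K| * η + 3 / 5 * ‖s‖ * η := by
          rw [e1]
          gcongr
          exact e2.trans h2
      _ ≤ (|K| + ‖s‖ + 1) * η := by
          have := abs_nonneg K
          have := norm_nonneg s
          nlinarith
      _ ≤ 4 / 5 * s.re / 2 := by rw [hηK]; linarith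
  obtain ⟨w, hw⟩ := exists_bounded_riccati hX hXt (κ := 4 / 5 * s) (by rw [hκ]; linarith)
    (b := fun y => -(a y * g y)) had (had.mul hgd).neg ha' hb'
  obtain ⟨R₁, hR₁⟩ := eventually_atTop.1 ((tendsto_rpow_atTop (y := (5 / 2 : ℝ))
    (by norm_num)).eventually_gt_atTop ρ)
  refine ⟨max R₁ 1, fun ν => -s * ν ^ (3 / 2 : ℂ) + w (ν ^ (5 / 2 : ℂ)), fun ν hν hR => ?_⟩
  have hν1 : 1 ≤ ‖ν‖ := (le_max_right _ _).trans hR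
  have hν0 : ν ≠ 0 := norm_pos_iff.1 (by linarith)
  have hνarg := abs_le.1 hν
  have hνslit : ν ∈ Complex.slitPlane := by
    rw [Complex.mem_slitPlane_iff_arg]
    exact ⟨by linarith, hν0⟩
  have hy : ν ^ (5 / 2 : ℂ) ∈ X := by
    have h1 : ρ < ‖ν‖ ^ (5 / 2 : ℝ) := hR₁ _ ((le_max_left _ _).trans hR)
    have h2 : 1 ≤ Real.cos (5 / 2 * ν.arg) + 8 * |Real.sin (5 / 2 * ν.arg)| := by
      refine one_le_cos_add_abs_sin ?_
      rw [abs_mul, abs_of_pos (by norm_num : (0 : ℝ) < 5 / 2)]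
      linarith
    change ρ < _
    rw [(re_im_cpow_five_halves hν0).1, (re_im_cpow_five_halves hν0).2, abs_mul,
      abs_of_pos (hρ0.trans h1)]
    nlinarith
  have hmul : ∀ c : ℂ, (ν ^ (5 / 2 : ℂ)) ^ c = ν ^ (5 / 2 * c) := by
    intro c
    have him : (Complex.log ν * (5 / 2 : ℂ)).im = ν.arg * (5 / 2) := by
      simp [Complex.mul_im, Complex.log_im]
    rw [Complex.cpow_mul]
    · rw [him]; linarith
    · rw [him]; linarith
  have hy1 : (ν ^ (5 / 2 : ℂ)) ^ (2 / 5 : ℂ) = ν := by rw [hmul]; norm_num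
  have hy2 : (ν ^ (5 / 2 : ℂ)) ^ (1 / 5 : ℂ) = ν ^ (1 / 2 : ℂ) := by rw [hmul]; norm_num
  have hy3 : (ν ^ (5 / 2 : ℂ)) ^ (-(3 / 5) : ℂ) * ν ^ (3 / 2 : ℂ) = 1 := by
    rw [hmul, ← Complex.cpow_add _ _ hν0]; norm_num
  have hy4 : (ν ^ (3 / 2 : ℂ)) ^ 2 = ν ^ 3 := by
    rw [← Complex.cpow_nat_mul, ← Complex.cpow_natCast]; norm_num
  obtain ⟨hw1, hw2⟩ := hw _ hy
  refine ⟨?_, by simpa using hw1⟩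
  have d1 : HasDerivAt (fun ν : ℂ => ν ^ (3 / 2 : ℂ)) (3 / 2 * ν ^ (1 / 2 : ℂ)) ν := by
    have := (hasDerivAt_id ν).cpow_const (c := (3 / 2 : ℂ)) hνslit
    refine this.congr_deriv ?_
    norm_num
  have d2 : HasDerivAt (fun ν : ℂ => ν ^ (5 / 2 : ℂ)) (5 / 2 * ν ^ (3 / 2 : ℂ)) ν := by
    have := (hasDerivAt_id ν).cpow_const (c := (5 / 2 : ℂ)) hνslit
    refine this.congr_deriv ?_
    norm_num
  refine ((d1.const_mul (-s)).add (hw2.comp ν d2)).congr_deriv ?_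
  simp only [ha, hg, hy1, hy2]
  set W := w (ν ^ (5 / 2 : ℂ))
  linear_combination s ^ 2 * hy4 -
    (W ^ 2 - (Q ν - s ^ 2 * ν ^ 3 + 3 / 2 * s * ν ^ (1 / 2 : ℂ))) * hy3

/-- The rotated form of `exists_riccati_model`: a solution of `v' = Q - v²` in the sector
`|arg (l / C)| ≤ 7π/20`. -/
lemma exists_riccati_sector {Q : ℂ → ℂ} {K R₀ : ℝ} {s C : ℂ}
    (hQd : ∀ l : ℂ, R₀ ≤ ‖l‖ → DifferentiableAt ℂ Q l)
    (hQ : ∀ l : ℂ, R₀ ≤ ‖l‖ → ‖Q l - 4 * l ^ 3‖ ≤ K * ‖l‖) (hC : ‖C‖ = 1)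
    (hsC : s ^ 2 = 4 * C ^ 5) (hs : 0 < s.re) :
    ∃ (R : ℝ) (v : ℂ → ℂ), ∀ ν : ℂ, |ν.arg| ≤ 7 * Real.pi / 20 → R ≤ ‖ν‖ →
      HasDerivAt v (Q (C * ν) - v (C * ν) ^ 2) (C * ν) ∧
        ‖v (C * ν) + s / C * ν ^ (3 / 2 : ℂ)‖ ≤ 1 := by
  have hC0 : C ≠ 0 := norm_ne_zero_iff.1 (by rw [hC]; exact one_ne_zero)
  have hn : ∀ ν : ℂ, ‖C * ν‖ = ‖ν‖ := fun ν => by rw [norm_mul, hC, one_mul]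
  obtain ⟨R, v, hv⟩ := exists_riccati_model (Q := fun ν => C ^ 2 * Q (C * ν)) (K := K) (R₀ := R₀)
    (s := s) (fun ν hν => ((hQd (C * ν) (by rwa [hn])).comp ν
      (differentiableAt_id.const_mul C)).const_mul _)
    (fun ν hν => by
      have h1 := hQ (C * ν) (by rwa [hn])
      rw [hn] at h1
      rw [hsC, show C ^ 2 * Q (C * ν) - 4 * C ^ 5 * ν ^ 3 =
        C ^ 2 * (Q (C * ν) - 4 * (C * ν) ^ 3) by ring, norm_mul, norm_pow, hC]
      simpa using h1) hs
  refine ⟨R, fun l => C⁻¹ * v (C⁻¹ * l), fun ν hν hR => ?_⟩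
  obtain ⟨h1, h2⟩ := hv ν hν hR
  have hCν : C⁻¹ * (C * ν) = ν := inv_mul_cancel_left₀ hC0 ν
  simp only [hCν]
  constructor
  · have h3 : HasDerivAt (fun l : ℂ => C⁻¹ * l) (C⁻¹ * 1) (C * ν) :=
      (hasDerivAt_id (C * ν)).const_mul C⁻¹
    rw [← hCν] at h1
    refine ((h1.comp (C * ν) h3).const_mul C⁻¹).congr_deriv ?_
    simp only [hCν]
    field_simp
  · rw [show C⁻¹ * v ν + s / C * ν ^ (3 / 2 : ℂ) = C⁻¹ * (v ν + s * ν ^ (3 / 2 : ℂ)) by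
      field_simp, norm_mul, norm_inv, hC]
    simpa using h2

/-! ### Two independent solutions on a cone around a Stokes boundary -/

lemma log_mul_exp_mul_I {z : ℂ} (hz : z ≠ 0) {u : ℝ} (h : |z.arg| + |u| < Real.pi) :
    Complex.log (z * Complex.exp (u * Complex.I)) = Complex.log z + u * Complex.I := by
  have h1 := abs_le.1 (abs_add_le z.arg u)
  have him : (Complex.log z + u * Complex.I).im = z.arg + u := by simp [Complex.log_im]
  conv_lhs => rw [← Complex.exp_log hz, ← Complex.exp_add]
  exact Complex.log_exp (by rw [him]; linarith) (by rw [him]; linarith)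

lemma arg_mul_exp_mul_I {z : ℂ} (hz : z ≠ 0) {u : ℝ} (h : |z.arg| + |u| < Real.pi) :
    (z * Complex.exp (u * Complex.I)).arg = z.arg + u := by
  rw [← Complex.log_im, log_mul_exp_mul_I hz h]; simp [Complex.log_im]

lemma mul_exp_mul_I_cpow {z : ℂ} (hz : z ≠ 0) {u : ℝ} (h : |z.arg| + |u| < Real.pi) (a : ℂ) :
    (z * Complex.exp (u * Complex.I)) ^ a = z ^ a * Complex.exp (u * Complex.I * a) := by
  rw [Complex.cpow_def_of_ne_zero (mul_ne_zero hz (Complex.exp_ne_zero _)),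
    Complex.cpow_def_of_ne_zero hz, log_mul_exp_mul_I hz h, ← Complex.exp_add]
  congr 1; ring

/-- The cone of half-angle `π / 4` around the positive real axis with vertex `R`. -/
def rightCone (R : ℝ) : Set ℂ := {z | |z.im| < z.re - R}

lemma isOpen_rightCone (R : ℝ) : IsOpen (rightCone R) :=
  isOpen_lt (by fun_prop) (by fun_prop)

lemma convex_rightCone (R : ℝ) : Convex ℝ (rightCone R) := by
  intro x hx y hy a b ha hb hab
  simp only [rightCone, mem_ofPred_eq, Complex.add_im, Complex.add_re, Complex.real_smul,
    Complex.re_ofReal_mul, Complex.im_ofReal_mul] at hx hy ⊢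
  rw [abs_lt] at hx hy ⊢
  obtain rfl : b = 1 - a := by linarith
  constructor <;> rcases ha.eq_or_lt with rfl | ha' <;> nlinarith

lemma lt_norm_of_mem_rightCone {R : ℝ} {z : ℂ} (hz : z ∈ rightCone R) : R < ‖z‖ := by
  have h1 : |z.im| < z.re - R := hz
  linarith [abs_nonneg z.im, (le_abs_self z.re).trans (Complex.abs_re_le_norm z)]

lemma abs_arg_le_of_mem_rightCone {R : ℝ} (hR : 0 ≤ R) {z : ℂ} (hz : z ∈ rightCone R) :
    |z.arg| ≤ Real.pi / 4 := by
  have h1 : |z.im| < z.re - R := hz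
  have hpi := Real.pi_pos
  have hre : 0 < z.re := by linarith [abs_nonneg z.im]
  have harg : |z.arg| < Real.pi / 2 := Complex.abs_arg_lt_pi_div_two_iff.2 (Or.inl hre)
  by_contra! hcon
  have h2 := Real.tan_lt_tan_of_lt_of_lt_pi_div_two (by linarith) harg hcon
  rw [Real.tan_pi_div_four] at h2
  have h3 : Real.tan |z.arg| ≤ |z.im| / z.re := by
    have h4 : |Real.tan z.arg| = |z.im| / z.re := by
      rw [Complex.tan_arg, abs_div, abs_of_pos hre]
    rw [← h4]
    rcases abs_cases z.arg with ⟨h5, -⟩ | ⟨h5, -⟩ <;> rw [h5]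
    · exact le_abs_self _
    · rw [Real.tan_neg]; exact neg_le_abs _
  rw [lt_iff_not_ge] at h2
  exact h2 (h3.trans ((div_le_one hre).2 (by linarith)))

/-- On a cone around the ray spanned by `c`, where `c⁵ = -1`, the Riccati equation `v' = Q - v²`
has two solutions that are `∓ (2i/c) (l/c)^{3/2}` up to a bounded error. They come from the two
sectors of `exists_riccati_sector` with bisectors `c e^{∓iπ/10}`. -/
lemma exists_riccati_pair {Q : ℂ → ℂ} {K R₀ : ℝ} {c : ℂ}
    (hQd : ∀ l : ℂ, R₀ ≤ ‖l‖ → DifferentiableAt ℂ Q l)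
    (hQ : ∀ l : ℂ, R₀ ≤ ‖l‖ → ‖Q l - 4 * l ^ 3‖ ≤ K * ‖l‖) (hc : ‖c‖ = 1) (hc5 : c ^ 5 = -1) :
    ∃ (R : ℝ) (v₁ v₂ : ℂ → ℂ), 0 ≤ R ∧ ∀ μ ∈ rightCone R,
      HasDerivAt v₁ (Q (c * μ) - v₁ (c * μ) ^ 2) (c * μ) ∧
      HasDerivAt v₂ (Q (c * μ) - v₂ (c * μ) ^ 2) (c * μ) ∧
      ‖v₁ (c * μ) + 2 * Complex.I / c * μ ^ (3 / 2 : ℂ)‖ ≤ 1 ∧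
      ‖v₂ (c * μ) - 2 * Complex.I / c * μ ^ (3 / 2 : ℂ)‖ ≤ 1 := by
  have hpi := Real.pi_pos
  have hc0 : c ≠ 0 := norm_ne_zero_iff.1 (by rw [hc]; exact one_ne_zero)
  have key : ∀ σ : ℝ, |σ| = 1 → ∃ (R : ℝ) (v : ℂ → ℂ), 0 ≤ R ∧ ∀ μ ∈ rightCone R,
      HasDerivAt v (Q (c * μ) - v (c * μ) ^ 2) (c * μ) ∧
      ‖v (c * μ) + 2 * Complex.exp ((σ * (Real.pi / 2) : ℝ) * Complex.I) / c *
        μ ^ (3 / 2 : ℂ)‖ ≤ 1 := by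
    intro σ hσ
    set u : ℝ := σ * (Real.pi / 10) with hu
    have huabs : |u| = Real.pi / 10 := by
      rw [hu, abs_mul, hσ, one_mul, abs_of_pos (by positivity)]
    set C : ℂ := c * Complex.exp ((-u : ℝ) * Complex.I) with hC
    set s : ℂ := 2 * Complex.exp ((σ * (Real.pi / 4) : ℝ) * Complex.I) with hs
    have hCn : ‖C‖ = 1 := by
      rw [hC, norm_mul, hc, Complex.norm_exp_ofReal_mul_I, one_mul]
    have hsC : s ^ 2 = 4 * C ^ 5 := by
      rw [hs, hC, mul_pow, mul_pow, hc5, ← Complex.exp_nat_mul, ← Complex.exp_nat_mul]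
      -- `e^{iσπ/2} = -e^{-iσπ/2}` because the exponents differ by `iσπ`, where `σ = ±1`
      have h1 : Complex.exp (σ * Real.pi * Complex.I) = -1 := by
        have : σ = 1 ∨ σ = -1 := by
          rcases abs_eq (by norm_num : (0 : ℝ) ≤ 1) |>.1 hσ with h | h
          · exact Or.inl h
          · exact Or.inr h
        rcases this with rfl | rfl
        · simp
        · simp [Complex.exp_neg]
      have h2 : ((2 : ℕ) : ℂ) * ((σ * (Real.pi / 4) : ℝ) * Complex.I) =
          σ * Real.pi * Complex.I + ((5 : ℕ) : ℂ) * ((-u : ℝ) * Complex.I) := by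
        rw [hu]; push_cast; ring
      rw [h2, Complex.exp_add, h1]
      ring
    have hsre : 0 < s.re := by
      rw [hs, Complex.exp_ofReal_mul_I]
      have hcos : 0 < Real.cos (σ * (Real.pi / 4)) := by
        have hle := abs_le.1 hσ.le
        exact Real.cos_pos_of_mem_Ioo ⟨by nlinarith, by nlinarith⟩
      simp only [Complex.mul_re, Complex.add_re, Complex.ofReal_re, Complex.re_ofNat,
        Complex.im_ofNat, zero_mul, sub_zero, Complex.ofReal_im, Complex.I_re, Complex.I_im,
        mul_zero, add_zero]
      linarith
    obtain ⟨R, v, hv⟩ := exists_riccati_sector hQd hQ hCn hsC hsre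
    refine ⟨max R 0, v, le_max_right _ _, fun μ hμ => ?_⟩
    have hμarg := abs_arg_le_of_mem_rightCone (le_max_right _ _) hμ
    have hμn := lt_norm_of_mem_rightCone hμ
    have hμ0 : μ ≠ 0 := norm_pos_iff.1 ((le_max_right _ _).trans_lt hμn)
    have hlt : |μ.arg| + |u| < Real.pi := by rw [huabs]; linarith
    set ν : ℂ := μ * Complex.exp (u * Complex.I) with hν
    have hCν : C * ν = c * μ := by
      have h1 : Complex.exp ((-u : ℝ) * Complex.I) * Complex.exp (u * Complex.I) = 1 := by
        rw [← Complex.exp_add]; simp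
      rw [hC, hν]
      linear_combination c * μ * h1
    have hνarg : |ν.arg| ≤ 7 * Real.pi / 20 := by
      rw [hν, arg_mul_exp_mul_I hμ0 hlt]
      exact (abs_add_le _ _).trans (by rw [huabs]; linarith)
    have hνn : R ≤ ‖ν‖ := by
      rw [hν, norm_mul, Complex.norm_exp_ofReal_mul_I, mul_one]
      exact (le_max_left _ _).trans hμn.le
    obtain ⟨h1, h2⟩ := hv ν hνarg hνn
    rw [hCν] at h1 h2
    refine ⟨h1, ?_⟩
    have h3 : s / C * ν ^ (3 / 2 : ℂ) =
        2 * Complex.exp ((σ * (Real.pi / 2) : ℝ) * Complex.I) / c * μ ^ (3 / 2 : ℂ) := by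
      rw [hν, mul_exp_mul_I_cpow hμ0 hlt, hs, hC]
      have h4 : Complex.exp ((σ * (Real.pi / 4) : ℝ) * Complex.I) *
          Complex.exp (u * Complex.I * (3 / 2)) =
          Complex.exp ((σ * (Real.pi / 2) : ℝ) * Complex.I) *
            Complex.exp ((-u : ℝ) * Complex.I) := by
        rw [← Complex.exp_add, ← Complex.exp_add, hu]
        congr 1; push_cast; ring
      have h5 := Complex.exp_ne_zero ((-u : ℝ) * Complex.I)
      rw [div_mul_eq_mul_div, div_mul_eq_mul_div, div_eq_div_iff (mul_ne_zero hc0 h5) hc0]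
      linear_combination 2 * c * μ ^ (3 / 2 : ℂ) * h4
    rw [← h3]
    exact h2
  obtain ⟨R₁, v₁, hR₁, hv₁⟩ := key 1 (by norm_num)
  obtain ⟨R₂, v₂, hR₂, hv₂⟩ := key (-1) (by norm_num)
  have e1 : Complex.exp (((1 : ℝ) * (Real.pi / 2) : ℝ) * Complex.I) = Complex.I := by
    rw [one_mul]; push_cast; exact Complex.exp_pi_div_two_mul_I
  have e2 : Complex.exp (((-1 : ℝ) * (Real.pi / 2) : ℝ) * Complex.I) = -Complex.I := by
    rw [← Complex.exp_neg_pi_div_two_mul_I]; congr 1; push_cast; ring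
  refine ⟨max R₁ R₂, v₁, v₂, hR₁.trans (le_max_left _ _), fun μ hμ => ?_⟩
  have hμ' : |μ.im| < μ.re - max R₁ R₂ := hμ
  have m1 : μ ∈ rightCone R₁ := show |μ.im| < μ.re - R₁ by linarith [le_max_left R₁ R₂]
  have m2 : μ ∈ rightCone R₂ := show |μ.im| < μ.re - R₂ by linarith [le_max_right R₁ R₂]
  obtain ⟨a1, b1⟩ := hv₁ μ m1
  obtain ⟨a2, b2⟩ := hv₂ μ m2
  rw [e1] at b1
  rw [e2] at b2
  refine ⟨a1, a2, b1, ?_⟩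
  convert b2 using 2
  ring

/-- On a cone around the ray spanned by `c`, where `c⁵ = -1`, a solution of the Schwarzian equation
is a Möbius transformation of a function `q` with `log |q| = (8/5) Im (l/c)^{5/2} + O(|l|)`. Here
`q` is the quotient of the solutions `exp (∫ v₁)` and `exp (∫ v₂)` of `φ'' = Q φ`. -/
lemma exists_quotient_on_cone {F Q : ℂ → ℂ} {f : ℂ → OnePoint ℂ} {K R₀ : ℝ} {c : ℂ}
    (hF : Meromorphic F)
    (hf : ∀ l : ℂ, Tendsto (fun x : ℂ => (F x : OnePoint ℂ)) (𝓝[≠] l) (𝓝 (f l)))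
    (hS : ∀ᶠ l in codiscrete ℂ, schwarzian F l = -2 * Q l)
    (hQd : ∀ l : ℂ, R₀ ≤ ‖l‖ → DifferentiableAt ℂ Q l)
    (hQ : ∀ l : ℂ, R₀ ≤ ‖l‖ → ‖Q l - 4 * l ^ 3‖ ≤ K * ‖l‖) (hc : ‖c‖ = 1) (hc5 : c ^ 5 = -1) :
    ∃ (α β γ δ : ℂ) (q : ℂ → ℂ) (R B : ℝ), α * δ - β * γ ≠ 0 ∧ ∀ l : ℂ, l / c ∈ rightCone R →
      f l = homog (α * q l + β) (γ * q l + δ) ∧ q l ≠ 0 ∧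
        |Real.log ‖q l‖ - 8 / 5 * ((l / c) ^ (5 / 2 : ℂ)).im| ≤ 2 * ‖l‖ + B := by
  have hc0 : c ≠ 0 := norm_ne_zero_iff.1 (by rw [hc]; exact one_ne_zero)
  obtain ⟨R₁, v₁, v₂, hR₁, hv⟩ := exists_riccati_pair hQd hQ hc hc5
  set R : ℝ := max R₁ (max R₀ (|K| + 1)) with hR
  have hRR₁ : R₁ ≤ R := le_max_left _ _
  have hRR₀ : R₀ ≤ R := (le_max_left _ _).trans (le_max_right _ _)
  have hRK : |K| + 1 ≤ R := (le_max_right _ _).trans (le_max_right _ _)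
  have hR0 : 0 ≤ R := hR₁.trans hRR₁
  set E : Set ℂ := {l | l / c ∈ rightCone R} with hE
  have hcl : ∀ l, c * (l / c) = l := fun l => mul_div_cancel₀ l hc0
  have hnl : ∀ l, ‖l / c‖ = ‖l‖ := fun l => by rw [norm_div, hc, div_one]
  have hEo : IsOpen E := (isOpen_rightCone R).preimage (continuous_id.div_const c)
  have hEc : Convex ℝ E := by
    intro x hx y hy a b ha hb hab
    have := convex_rightCone R hx hy ha hb hab
    simp only [hE, mem_ofPred_eq]
    convert this using 1
    simp only [Complex.real_smul]
    ring
  have hEn : ∀ l ∈ E, R < ‖l‖ := fun l hl => by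
    rw [← hnl l]; exact lt_norm_of_mem_rightCone hl
  have hmem : ∀ l ∈ E, l / c ∈ rightCone R₁ := fun l hl => by
    have h1 : |(l / c).im| < (l / c).re - R := hl
    exact show |(l / c).im| < (l / c).re - R₁ by linarith
  have hv' : ∀ l ∈ E, HasDerivAt v₁ (Q l - v₁ l ^ 2) l ∧ HasDerivAt v₂ (Q l - v₂ l ^ 2) l ∧
      ‖v₁ l + 2 * Complex.I / c * (l / c) ^ (3 / 2 : ℂ)‖ ≤ 1 ∧
      ‖v₂ l - 2 * Complex.I / c * (l / c) ^ (3 / 2 : ℂ)‖ ≤ 1 := by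
    intro l hl
    have h := hv _ (hmem l hl)
    rwa [hcl] at h
  have h1K : ∀ l ∈ E, 1 ≤ ‖l‖ ∧ |K| < ‖l‖ := fun l hl =>
    ⟨by linarith [hEn l hl, abs_nonneg K], by linarith [hEn l hl]⟩
  -- the leading term `4 l³` dominates the error
  have hQ0 : ∀ l ∈ E, Q l ≠ 0 := by
    intro l hl h0
    have h1 := hQ l (hRR₀.trans (hEn l hl).le)
    rw [h0, zero_sub, norm_neg, norm_mul, norm_pow, Complex.norm_ofNat] at h1
    obtain ⟨h2, h3⟩ := h1K l hl
    have h4 : K * ‖l‖ ≤ ‖l‖ * ‖l‖ := by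
      gcongr
      exact (le_abs_self K).trans h3.le
    nlinarith [mul_le_mul_of_nonneg_left h2 (by positivity : 0 ≤ ‖l‖ * ‖l‖),
      mul_pos (by linarith : 0 < ‖l‖) (by linarith : 0 < ‖l‖)]
  have hvne : ∀ l ∈ E, v₂ l - v₁ l ≠ 0 := by
    intro l hl h0
    obtain ⟨-, -, h1, h2⟩ := hv' l hl
    set m : ℂ := 2 * Complex.I / c * (l / c) ^ (3 / 2 : ℂ) with hm
    have hmn : 2 ≤ ‖m‖ := by
      have hl0 : l / c ≠ 0 := norm_pos_iff.1 (by rw [hnl]; linarith [h1K l hl])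
      rw [hm, norm_mul, norm_div, hc, norm_mul, Complex.norm_I,
        norm_cpow_of_im_eq_zero hl0 (by norm_num), hnl]
      have := Real.one_le_rpow (h1K l hl).1 (z := ((3 / 2 : ℂ)).re) (by norm_num)
      simp only [Complex.norm_ofNat, mul_one, div_one]
      linarith
    have h3 : 2 * m = (v₁ l + m) - (v₂ l - m) := by linear_combination h0
    have h4 := norm_sub_le (v₁ l + m) (v₂ l - m)
    rw [← h3, norm_mul, Complex.norm_ofNat] at h4
    linarith
  obtain ⟨P₁, hP₁⟩ := hEc.exists_forall_hasDerivWithinAt (𝕜 := ℂ) (f := v₁)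
    (fun l hl => (hv' l hl).1.differentiableAt.differentiableWithinAt)
  obtain ⟨P₂, hP₂⟩ := hEc.exists_forall_hasDerivWithinAt (𝕜 := ℂ) (f := v₂)
    (fun l hl => (hv' l hl).2.1.differentiableAt.differentiableWithinAt)
  replace hP₁ : ∀ l ∈ E, HasDerivAt P₁ (v₁ l) l := fun l hl =>
    (hP₁ l hl).hasDerivAt (hEo.mem_nhds hl)
  replace hP₂ : ∀ l ∈ E, HasDerivAt P₂ (v₂ l) l := fun l hl =>
    (hP₂ l hl).hasDerivAt (hEo.mem_nhds hl)
  have hlin : ∀ {P v : ℂ → ℂ} {l : ℂ}, HasDerivAt P (v l) l → HasDerivAt v (Q l - v l ^ 2) l →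
      HasDerivAt (fun l => Complex.exp (P l)) (v l * Complex.exp (P l)) l ∧
      HasDerivAt (fun l => v l * Complex.exp (P l)) (Q l * Complex.exp (P l)) l := by
    intro P v l hP hv
    have h1 : HasDerivAt (fun l => Complex.exp (P l)) (v l * Complex.exp (P l)) l :=
      hP.cexp.congr_deriv (mul_comm _ _)
    exact ⟨h1, (hv.mul h1).congr_deriv (by ring)⟩
  set x₀ : ℂ := c * ((R + 1 : ℝ) : ℂ) with hx₀
  have hbase : x₀ ∈ E := by
    change |(c * ((R + 1 : ℝ) : ℂ) / c).im| < (c * ((R + 1 : ℝ) : ℂ) / c).re - R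
    rw [mul_div_cancel_left₀ _ hc0, Complex.ofReal_im, Complex.ofReal_re]
    simp
  obtain ⟨α, β, γ, δ, hdet, hfE⟩ := exists_eq_homog (E := E) hF hf hS hEo
    ⟨⟨_, hbase⟩, hEc.isPreconnected⟩ hQ0
    (fun l hl => (hlin (hP₁ l hl) (hv' l hl).1).1) (fun l hl => (hlin (hP₁ l hl) (hv' l hl).1).2)
    (fun l hl => (hlin (hP₂ l hl) (hv' l hl).2.1).1)
    (fun l hl => (hlin (hP₂ l hl) (hv' l hl).2.1).2)
    (fun l _ => Complex.exp_ne_zero _) (fun l hl => by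
      rw [show Complex.exp (P₁ l) * (v₂ l * Complex.exp (P₂ l)) -
        v₁ l * Complex.exp (P₁ l) * Complex.exp (P₂ l) =
        (v₂ l - v₁ l) * (Complex.exp (P₁ l) * Complex.exp (P₂ l)) by ring]
      exact mul_ne_zero (hvne l hl) (mul_ne_zero (Complex.exp_ne_zero _) (Complex.exp_ne_zero _)))
  -- the error term in the exponent is Lipschitz
  set e : ℂ → ℂ := fun l => P₁ l - P₂ l + 8 / 5 * Complex.I * (l / c) ^ (5 / 2 : ℂ) with he
  have hed : ∀ l ∈ E, HasDerivAt e ((v₁ l + 2 * Complex.I / c * (l / c) ^ (3 / 2 : ℂ)) -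
      (v₂ l - 2 * Complex.I / c * (l / c) ^ (3 / 2 : ℂ))) l := by
    intro l hl
    have hslit : l / c ∈ Complex.slitPlane := by
      have h1 : |(l / c).im| < (l / c).re - R := hl
      exact Or.inl (by linarith [abs_nonneg (l / c).im])
    have h1 : HasDerivAt (fun l : ℂ => (l / c) ^ (5 / 2 : ℂ))
        (5 / 2 * (l / c) ^ (3 / 2 : ℂ) * (1 / c)) l := by
      refine (((hasDerivAt_id l).div_const c).cpow_const (c := (5 / 2 : ℂ)) hslit).congr_deriv ?_
      norm_num
    refine (((hP₁ l hl).sub (hP₂ l hl)).add (h1.const_mul (8 / 5 * Complex.I))).congr_deriv ?_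
    field_simp
    ring
  have heb : ∀ l ∈ E, ‖e l‖ ≤ 2 * ‖l‖ + (‖e x₀‖ + 2 * ‖x₀‖) := by
    intro l hl
    have h1 := hEc.norm_image_sub_le_of_norm_hasDerivWithin_le (C := 2)
      (fun x hx => (hed x hx).hasDerivWithinAt)
      (fun x hx => (norm_sub_le _ _).trans
        (by linarith [(hv' x hx).2.2.1, (hv' x hx).2.2.2])) hbase hl
    have h2 := norm_sub_norm_le (e l) (e x₀)
    have h3 := norm_sub_le l x₀
    linarith
  refine ⟨α, β, γ, δ, fun l => Complex.exp (P₁ l - P₂ l), R, ‖e x₀‖ + 2 * ‖x₀‖, hdet,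
    fun l hl => ⟨?_, Complex.exp_ne_zero _, ?_⟩⟩
  · rw [hfE l hl]
    refine Eq.trans ?_ (homog_mul_left (Complex.exp_ne_zero (P₂ l)) _ _)
    have h1 : Complex.exp (P₂ l) * Complex.exp (P₁ l - P₂ l) = Complex.exp (P₁ l) := by
      rw [← Complex.exp_add]; congr 1; ring
    congr 1
    · linear_combination -α * h1
    · linear_combination -γ * h1
  · rw [Complex.norm_exp, Real.log_exp]
    refine le_trans (le_of_eq ?_) ((Complex.abs_re_le_norm (e l)).trans (heb l hl))
    congr 1
    simp [he, Complex.mul_re, Complex.mul_im]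
    ring

/-! ### Decay on the two sides of a Stokes boundary -/

/-- Along the filter `F` of points of the plane, `f` converges to `w`, with a chordal distance
decaying faster than every exponential of the modulus. -/
def DecaysTo (f : ℂ → OnePoint ℂ) (F : Filter ℂ) (w : OnePoint ℂ) : Prop :=
  Tendsto f F (𝓝 w) ∧
    ∀ C : ℝ, Tendsto (fun l => Real.exp (C * ‖l‖) * chordalDist (f l) w) F (𝓝 0)

/-- If `f = (α + β ε) / (γ + δ ε)` with `ε` decaying faster than every exponential, then `f` decays
to `α / γ`: the chordal distance is `|ε|` times a factor with a finite limit. -/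
lemma DecaysTo.of_homog {f : ℂ → OnePoint ℂ} {F : Filter ℂ} {α β γ δ : ℂ} {ε : ℂ → ℂ}
    (hdet : α * δ - β * γ ≠ 0)
    (hf : ∀ᶠ l in F, f l = homog (α + β * ε l) (γ + δ * ε l))
    (hε : ∀ C : ℝ, Tendsto (fun l => Real.exp (C * ‖l‖) * ‖ε l‖) F (𝓝 0)) :
    DecaysTo f F (homog α γ) := by
  have hε0 : Tendsto ε F (𝓝 0) := by
    rw [tendsto_zero_iff_norm_tendsto_zero]
    simpa using hε 0
  have hp : Tendsto (fun l => α + β * ε l) F (𝓝 α) := by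
    simpa using tendsto_const_nhds.add (hε0.const_mul β)
  have hq : Tendsto (fun l => γ + δ * ε l) F (𝓝 γ) := by
    simpa using tendsto_const_nhds.add (hε0.const_mul δ)
  have hne : α ≠ 0 ∨ γ ≠ 0 := by
    by_contra! hcon
    exact hdet (by rw [hcon.1, hcon.2]; ring)
  refine ⟨(tendsto_homog hp hq hne).congr' (hf.mono fun l hl => hl.symm), fun C => ?_⟩
  have hpos : 0 < √(‖α‖ ^ 2 + ‖γ‖ ^ 2) := by
    refine Real.sqrt_pos.2 ?_
    rcases hne with h | h
    · have := norm_pos_iff.2 h; positivity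
    · have := norm_pos_iff.2 h; positivity
  have hden : Tendsto (fun l => √(‖α + β * ε l‖ ^ 2 + ‖γ + δ * ε l‖ ^ 2) * √(‖α‖ ^ 2 + ‖γ‖ ^ 2)) F
      (𝓝 (√(‖α‖ ^ 2 + ‖γ‖ ^ 2) * √(‖α‖ ^ 2 + ‖γ‖ ^ 2))) :=
    ((Real.continuous_sqrt.tendsto _).comp ((hp.norm.pow 2).add (hq.norm.pow 2))).mul_const _
  have hlim := ((hε C).const_mul (2 * ‖β * γ - α * δ‖)).div hden (by positivity)
  rw [mul_zero, zero_div] at hlim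
  have hne' : ∀ᶠ l in F, α + β * ε l ≠ 0 ∨ γ + δ * ε l ≠ 0 := by
    rcases hne with h | h
    · exact (hp.eventually_ne h).mono fun _ => Or.inl
    · exact (hq.eventually_ne h).mono fun _ => Or.inr
  refine hlim.congr' ?_
  filter_upwards [hf, hne'] with l h1 h2
  rw [h1, chordalDist_homog h2 hne, show (α + β * ε l) * γ - α * (γ + δ * ε l) =
    (β * γ - α * δ) * ε l by ring, norm_mul]
  simp only [Pi.div_apply]
  ring

/-- The points at distance at least `δ` above the ray spanned by `c`, at an angle at most `π / 5`
from it. -/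
def aboveRay (c : ℂ) (δ : ℝ) : Set ℂ := {l | |(l / c).arg| ≤ Real.pi / 5 ∧ δ ≤ (l / c).im}

/-- The points at distance at least `δ` below the ray spanned by `c`, at an angle at most `π / 5`
from it. -/
def belowRay (c : ℂ) (δ : ℝ) : Set ℂ := {l | |(l / c).arg| ≤ Real.pi / 5 ∧ (l / c).im ≤ -δ}

/-- This bound keeps the decay superexponential along rays parallel to the ray spanned by `c`: there
`Im z` is merely bounded below, but the factor `|z|^{3/2}` still beats every multiple of `|z|`. -/
lemma norm_rpow_mul_im_le {z : ℂ} (hz : z ≠ 0) (h0 : 0 ≤ z.arg) (h : z.arg ≤ Real.pi / 5) :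
    ‖z‖ ^ (3 / 2 : ℝ) * z.im ≤ (z ^ (5 / 2 : ℂ)).im := by
  have hpi := Real.pi_pos
  have hn := norm_pos_iff.2 hz
  rw [(re_im_cpow_five_halves hz).2, ← Complex.norm_mul_sin_arg z, ← mul_assoc]
  have h1 : ‖z‖ ^ (3 / 2 : ℝ) * ‖z‖ = ‖z‖ ^ (5 / 2 : ℝ) := by
    nth_rw 2 [← Real.rpow_one ‖z‖]
    rw [← Real.rpow_add hn]; norm_num
  rw [h1]
  gcongr
  exact Real.sin_le_sin_of_le_of_le_pi_div_two (by linarith) (by linarith) (by linarith)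

lemma im_cpow_le_norm_rpow_mul_im {z : ℂ} (hz : z ≠ 0) (h0 : z.arg ≤ 0)
    (h : -(Real.pi / 5) ≤ z.arg) :
    (z ^ (5 / 2 : ℂ)).im ≤ ‖z‖ ^ (3 / 2 : ℝ) * z.im := by
  have hpi := Real.pi_pos
  have hn := norm_pos_iff.2 hz
  rw [(re_im_cpow_five_halves hz).2, ← Complex.norm_mul_sin_arg z, ← mul_assoc]
  have h1 : ‖z‖ ^ (3 / 2 : ℝ) * ‖z‖ = ‖z‖ ^ (5 / 2 : ℝ) := by
    nth_rw 2 [← Real.rpow_one ‖z‖]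
    rw [← Real.rpow_add hn]; norm_num
  rw [h1]
  gcongr
  exact Real.sin_le_sin_of_le_of_le_pi_div_two (by linarith) (by linarith) (by linarith)

lemma tendsto_exp_sub_rpow {δ : ℝ} (hδ : 0 < δ) (A B : ℝ) :
    Tendsto (fun x : ℝ => Real.exp (A * x + B - δ * x ^ (3 / 2 : ℝ))) atTop (𝓝 0) := by
  refine Real.tendsto_exp_atBot.comp ?_
  have h1 : Tendsto (fun x : ℝ => x * (A - δ * x ^ (1 / 2 : ℝ))) atTop atBot := by
    refine tendsto_id.atTop_mul_atBot₀ ?_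
    refine tendsto_atBot_add_const_left _ A (f := fun x : ℝ => -(δ * x ^ (1 / 2 : ℝ))) ?_
    exact tendsto_neg_atTop_atBot.comp ((tendsto_rpow_atTop (by norm_num)).const_mul_atTop hδ)
  refine (tendsto_atBot_add_const_right _ B h1).congr' ?_
  filter_upwards [eventually_gt_atTop 0] with x hx
  have h2 : x * x ^ (1 / 2 : ℝ) = x ^ (3 / 2 : ℝ) := by
    nth_rw 1 [← Real.rpow_one x]
    rw [← Real.rpow_add hx]; norm_num
  rw [← h2]; ring

lemma eventually_mem_rightCone {c : ℂ} (hc : ‖c‖ = 1) (R : ℝ) :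
    ∀ᶠ l in Bornology.cobounded ℂ, |(l / c).arg| ≤ Real.pi / 5 → l / c ∈ rightCone R := by
  have hpi := Real.pi_pos
  have hκ : 0 < Real.cos (Real.pi / 5) - Real.sin (Real.pi / 5) := by
    have h1 : Real.sin (Real.pi / 5) < Real.sin (Real.pi / 4) :=
      Real.sin_lt_sin_of_lt_of_le_pi_div_two (by linarith) (by linarith) (by linarith)
    have h2 : Real.cos (Real.pi / 4) < Real.cos (Real.pi / 5) :=
      Real.cos_lt_cos_of_nonneg_of_le_pi_div_two (by linarith) (by linarith) (by linarith)
    rw [Real.sin_pi_div_four] at h1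
    rw [Real.cos_pi_div_four] at h2
    linarith
  set κ := Real.cos (Real.pi / 5) - Real.sin (Real.pi / 5) with hκdef
  filter_upwards [tendsto_norm_cobounded_atTop.eventually (eventually_gt_atTop (R / κ))]
    with l hl harg
  have hn : ‖l / c‖ = ‖l‖ := by rw [norm_div, hc, div_one]
  set z := l / c
  rw [← hn, div_lt_iff₀ hκ] at hl
  change |z.im| < z.re - R
  have h1 : Real.cos (Real.pi / 5) ≤ Real.cos z.arg := by
    rw [← Real.cos_abs z.arg]
    exact Real.cos_le_cos_of_nonneg_of_le_pi (abs_nonneg _) (by linarith) harg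
  have h2 : |Real.sin z.arg| ≤ Real.sin (Real.pi / 5) := by
    rw [abs_le] at harg ⊢
    rw [← Real.sin_neg]
    exact ⟨Real.sin_le_sin_of_le_of_le_pi_div_two (by linarith) (by linarith) (by linarith),
      Real.sin_le_sin_of_le_of_le_pi_div_two (by linarith) (by linarith) (by linarith)⟩
  rw [← Complex.norm_mul_cos_arg z, ← Complex.norm_mul_sin_arg z, abs_mul, abs_norm]
  nlinarith [norm_nonneg z]

/-- If `|ε l| ≤ exp (2 |l| + B - (8/5) δ |l|^{3/2})` along `F`, then `ε` decays faster than every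
exponential. -/
lemma tendsto_exp_mul_norm_of_le {F : Filter ℂ} (hF : F ≤ Bornology.cobounded ℂ) {ε : ℂ → ℂ}
    {δ B : ℝ} (hδ : 0 < δ) (h : ∀ᶠ l in F,
      ‖ε l‖ ≤ Real.exp (2 * ‖l‖ + B - 8 / 5 * δ * ‖l‖ ^ (3 / 2 : ℝ))) (C : ℝ) :
    Tendsto (fun l => Real.exp (C * ‖l‖) * ‖ε l‖) F (𝓝 0) := by
  have hlim := (tendsto_exp_sub_rpow (δ := 8 / 5 * δ) (by positivity) (C + 2) B).comp
    (tendsto_norm_cobounded_atTop.mono_left hF)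
  refine squeeze_zero' (Eventually.of_forall fun _ => by positivity) ?_ hlim
  filter_upwards [h] with l hl
  calc Real.exp (C * ‖l‖) * ‖ε l‖
      ≤ Real.exp (C * ‖l‖) * Real.exp (2 * ‖l‖ + B - 8 / 5 * δ * ‖l‖ ^ (3 / 2 : ℝ)) := by gcongr
    _ = _ := by
      rw [← Real.exp_add, Function.comp_apply]
      congr 1; ring

/-- On the two sides of the ray spanned by `c`, where `c⁵ = -1`, the solution `f` decays to two
different values. -/
lemma exists_decaysTo_aboveRay_belowRay {F Q : ℂ → ℂ} {f : ℂ → OnePoint ℂ} {K R₀ : ℝ} {c : ℂ}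
    (hF : Meromorphic F)
    (hf : ∀ l : ℂ, Tendsto (fun x : ℂ => (F x : OnePoint ℂ)) (𝓝[≠] l) (𝓝 (f l)))
    (hS : ∀ᶠ l in codiscrete ℂ, schwarzian F l = -2 * Q l)
    (hQd : ∀ l : ℂ, R₀ ≤ ‖l‖ → DifferentiableAt ℂ Q l)
    (hQ : ∀ l : ℂ, R₀ ≤ ‖l‖ → ‖Q l - 4 * l ^ 3‖ ≤ K * ‖l‖) (hc : ‖c‖ = 1) (hc5 : c ^ 5 = -1) :
    ∃ wa wb : OnePoint ℂ, wa ≠ wb ∧ ∀ δ : ℝ, 0 < δ →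
      DecaysTo f (Bornology.cobounded ℂ ⊓ 𝓟 (aboveRay c δ)) wa ∧
      DecaysTo f (Bornology.cobounded ℂ ⊓ 𝓟 (belowRay c δ)) wb := by
  obtain ⟨α, β, γ, δ', q, R, B, hdet, h⟩ := exists_quotient_on_cone hF hf hS hQd hQ hc hc5
  have hnl : ∀ l, ‖l / c‖ = ‖l‖ := fun l => by rw [norm_div, hc, div_one]
  refine ⟨homog α γ, homog β δ', homog_ne_homog (by convert hdet using 1), fun δ hδ =>
    ⟨?_, ?_⟩⟩
  · have hev : ∀ᶠ l in Bornology.cobounded ℂ ⊓ 𝓟 (aboveRay c δ),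
        l / c ∈ rightCone R ∧ l ∈ aboveRay c δ := by
      rw [eventually_inf_principal]
      filter_upwards [eventually_mem_rightCone hc R] with l h1 h2
      exact ⟨h1 h2.1, h2⟩
    refine DecaysTo.of_homog (ε := fun l => (q l)⁻¹) hdet ?_
      (tendsto_exp_mul_norm_of_le (B := B) inf_le_left hδ ?_)
    · filter_upwards [hev] with l hl
      obtain ⟨h1, h2, -⟩ := h l hl.1
      rw [h1, ← homog_mul_left h2 (α + β * (q l)⁻¹)]
      congr 1 <;> field_simp
    · filter_upwards [hev] with l hl
      obtain ⟨-, h2, h3⟩ := h l hl.1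
      obtain ⟨h4, h5⟩ := hl.2
      have hz : l / c ≠ 0 := fun h0 => by rw [h0, Complex.zero_im] at h5; linarith
      have h6 := norm_rpow_mul_im_le hz (Complex.arg_nonneg_iff.2 (hδ.le.trans h5)) (abs_le.1 h4).2
      rw [hnl] at h6
      have h7 : δ * ‖l‖ ^ (3 / 2 : ℝ) ≤ ‖l‖ ^ (3 / 2 : ℝ) * (l / c).im := by
        rw [mul_comm]; gcongr
      rw [norm_inv, ← Real.exp_log (norm_pos_iff.2 h2), ← Real.exp_neg]
      refine Real.exp_le_exp.2 ?_
      linarith [(abs_le.1 h3).1]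
  · have hev : ∀ᶠ l in Bornology.cobounded ℂ ⊓ 𝓟 (belowRay c δ),
        l / c ∈ rightCone R ∧ l ∈ belowRay c δ := by
      rw [eventually_inf_principal]
      filter_upwards [eventually_mem_rightCone hc R] with l h1 h2
      exact ⟨h1 h2.1, h2⟩
    refine DecaysTo.of_homog (β := α) (δ := γ) (ε := q) ?_ ?_
      (tendsto_exp_mul_norm_of_le (B := B) inf_le_left hδ ?_)
    · intro h0
      exact hdet (by linear_combination -h0)
    · filter_upwards [hev] with l hl
      rw [(h l hl.1).1, add_comm β, add_comm δ']
    · filter_upwards [hev] with l hl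
      obtain ⟨-, h2, h3⟩ := h l hl.1
      obtain ⟨h4, h5⟩ := hl.2
      have hz : l / c ≠ 0 := fun h0 => by rw [h0, Complex.zero_im] at h5; linarith
      have h6 := im_cpow_le_norm_rpow_mul_im hz
        (Complex.arg_neg_iff.2 (by linarith)).le (abs_le.1 h4).1
      rw [hnl] at h6
      have h7 : ‖l‖ ^ (3 / 2 : ℝ) * (l / c).im ≤ ‖l‖ ^ (3 / 2 : ℝ) * (-δ) := by gcongr
      rw [← Real.exp_log (norm_pos_iff.2 h2)]
      refine Real.exp_le_exp.2 ?_
      linarith [(abs_le.1 h3).2]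

/-! ### The Stokes sectors -/

/-- The unit vector spanning the common boundary ray of the sectors `S_k` and `S_{k+1}`. -/
noncomputable def stokesBoundary (k : ZMod 5) : ℂ :=
  Complex.exp (((2 * k.val + 1) * Real.pi / 5 : ℝ) * Complex.I)

lemma norm_stokesBoundary (k : ZMod 5) : ‖stokesBoundary k‖ = 1 :=
  Complex.norm_exp_ofReal_mul_I _

lemma stokesBoundary_pow_five (k : ZMod 5) : stokesBoundary k ^ 5 = -1 := by
  rw [stokesBoundary, ← Complex.exp_nat_mul]
  have h1 : ((5 : ℕ) : ℂ) * (((2 * k.val + 1) * Real.pi / 5 : ℝ) * Complex.I) =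
      Real.pi * Complex.I + k.val * (2 * Real.pi * Complex.I) := by
    push_cast; ring
  rw [h1, Complex.exp_add, Complex.exp_nat_mul, Complex.exp_two_pi_mul_I, one_pow, mul_one,
    Complex.exp_pi_mul_I]

/-- The rotation taking the bisector of `S_k` to the positive real axis. -/
noncomputable def stokesRotate (k : ZMod 5) (l : ℂ) : ℂ :=
  l * Complex.exp (-(2 * Real.pi * (k.val : ℂ) / 5 * Complex.I))

lemma stokesAngle_eq_arg (k : ZMod 5) (l : ℂ) : stokesAngle k l = (stokesRotate k l).arg := rfl

lemma norm_stokesRotate (k : ZMod 5) (l : ℂ) : ‖stokesRotate k l‖ = ‖l‖ := by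
  rw [stokesRotate, norm_mul, show -(2 * Real.pi * (k.val : ℂ) / 5 * Complex.I) =
    ((-(2 * Real.pi * k.val / 5) : ℝ) : ℂ) * Complex.I by push_cast; ring,
    Complex.norm_exp_ofReal_mul_I, mul_one]

lemma div_stokesBoundary (k : ZMod 5) (l : ℂ) :
    l / stokesBoundary k = stokesRotate k l * Complex.exp ((-(Real.pi / 5) : ℝ) * Complex.I) := by
  rw [stokesBoundary, stokesRotate, div_eq_mul_inv, ← Complex.exp_neg, mul_assoc,
    ← Complex.exp_add]
  congr 2; push_cast; ring

/-- Passing from the sector `k` to `k + 1` rotates by `2π / 5`, also where `ZMod.val` wraps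
around. -/
lemma exp_stokesBisector_add_one (k : ZMod 5) :
    Complex.exp (-(2 * Real.pi * ((k + 1).val : ℂ) / 5 * Complex.I)) =
      Complex.exp (-(2 * Real.pi * ((k.val + 1 : ℕ) : ℂ) / 5 * Complex.I)) := by
  rw [Complex.exp_eq_exp_iff_exists_int]
  have h : (k + 1).val = (k.val + 1) % 5 := by
    rw [ZMod.val_add]; rfl
  refine ⟨(((k.val + 1) / 5 : ℕ) : ℤ), ?_⟩
  have h2 := Nat.div_add_mod (k.val + 1) 5
  rw [← h] at h2
  have h3 : ((5 * ((k.val + 1) / 5) + (k + 1).val : ℕ) : ℂ) = ((k.val + 1 : ℕ) : ℂ) := by rw [h2]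
  rw [Int.cast_natCast]
  generalize (k.val + 1) / 5 = n at h3 ⊢
  push_cast at h3 ⊢
  linear_combination (-2 * Real.pi / 5 * Complex.I) * h3

lemma div_stokesBoundary_sub_one (k : ZMod 5) (l : ℂ) :
    l / stokesBoundary (k - 1) =
      stokesRotate k l * Complex.exp ((Real.pi / 5 : ℝ) * Complex.I) := by
  obtain ⟨j, rfl⟩ : ∃ j, k = j + 1 := ⟨k - 1, by ring⟩
  rw [add_sub_cancel_right, stokesBoundary, stokesRotate, exp_stokesBisector_add_one,
    div_eq_mul_inv, ← Complex.exp_neg, mul_assoc, ← Complex.exp_add]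
  congr 2; push_cast; ring

lemma arg_div_stokesBoundary {k : ZMod 5} {l : ℂ} (hl : l ≠ 0)
    (h : |stokesAngle k l| ≤ Real.pi / 5) :
    (l / stokesBoundary k).arg = stokesAngle k l - Real.pi / 5 := by
  have hpi := Real.pi_pos
  have hl' : stokesRotate k l ≠ 0 := norm_ne_zero_iff.1 (by
    rw [norm_stokesRotate]; exact norm_ne_zero_iff.2 hl)
  rw [div_stokesBoundary, arg_mul_exp_mul_I hl']
  · rw [← stokesAngle_eq_arg]; ring
  · rw [← stokesAngle_eq_arg, abs_neg,
      abs_of_pos (div_pos hpi (by norm_num : (0 : ℝ) < 5))]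
    linarith

lemma arg_div_stokesBoundary_sub_one {k : ZMod 5} {l : ℂ} (hl : l ≠ 0)
    (h : |stokesAngle k l| ≤ Real.pi / 5) :
    (l / stokesBoundary (k - 1)).arg = stokesAngle k l + Real.pi / 5 := by
  have hpi := Real.pi_pos
  have hl' : stokesRotate k l ≠ 0 := norm_ne_zero_iff.1 (by
    rw [norm_stokesRotate]; exact norm_ne_zero_iff.2 hl)
  rw [div_stokesBoundary_sub_one, arg_mul_exp_mul_I hl']
  · rw [← stokesAngle_eq_arg]
  · rw [← stokesAngle_eq_arg, abs_of_pos (div_pos hpi (by norm_num : (0 : ℝ) < 5))]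
    linarith

/-- The points of `S_k` at distance at least `δ` from the boundary ray that is nearer in angle. -/
def stokesInterior (k : ZMod 5) (δ : ℝ) : Set ℂ :=
  belowRay (stokesBoundary k) δ ∪ aboveRay (stokesBoundary (k - 1)) δ

lemma mem_belowRay_stokesBoundary {k : ZMod 5} {l : ℂ} {ε δ : ℝ} (hl : l ≠ 0) (hε : 0 ≤ ε)
    (h0 : 0 ≤ stokesAngle k l) (h1 : stokesAngle k l ≤ Real.pi / 5 - ε)
    (hδ : δ ≤ ‖l‖ * Real.sin ε) : l ∈ belowRay (stokesBoundary k) δ := by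
  have hpi := Real.pi_pos
  have harg := arg_div_stokesBoundary (k := k) hl (by rw [abs_of_nonneg h0]; linarith)
  have hn : ‖l / stokesBoundary k‖ = ‖l‖ := by rw [norm_div, norm_stokesBoundary, div_one]
  refine ⟨by rw [harg, abs_le]; constructor <;> linarith, ?_⟩
  rw [← Complex.norm_mul_sin_arg, hn, harg, ← neg_sub, Real.sin_neg, mul_neg]
  have h2 : Real.sin ε ≤ Real.sin (Real.pi / 5 - stokesAngle k l) :=
    Real.sin_le_sin_of_le_of_le_pi_div_two (by linarith) (by linarith) (by linarith)
  exact neg_le_neg (hδ.trans (by gcongr))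

lemma mem_aboveRay_stokesBoundary {k : ZMod 5} {l : ℂ} {ε δ : ℝ} (hl : l ≠ 0) (hε : 0 ≤ ε)
    (h0 : stokesAngle k l ≤ 0) (h1 : -(Real.pi / 5 - ε) ≤ stokesAngle k l)
    (hδ : δ ≤ ‖l‖ * Real.sin ε) : l ∈ aboveRay (stokesBoundary (k - 1)) δ := by
  have hpi := Real.pi_pos
  have harg := arg_div_stokesBoundary_sub_one (k := k) hl (by rw [abs_of_nonpos h0]; linarith)
  have hn : ‖l / stokesBoundary (k - 1)‖ = ‖l‖ := by rw [norm_div, norm_stokesBoundary, div_one]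
  refine ⟨by rw [harg, abs_le]; constructor <;> linarith, ?_⟩
  rw [← Complex.norm_mul_sin_arg, hn, harg]
  have h2 : Real.sin ε ≤ Real.sin (stokesAngle k l + Real.pi / 5) :=
    Real.sin_le_sin_of_le_of_le_pi_div_two (by linarith) (by linarith) (by linarith)
  exact hδ.trans (by gcongr)

/-- The bisector of `S_k`, with the initial point at distance one from the origin. -/
noncomputable def stokesBisector (k : ZMod 5) (t : ℝ) : ℂ :=
  ((t + 1 : ℝ) : ℂ) * Complex.exp ((2 * Real.pi * k.val / 5 : ℝ) * Complex.I)

lemma norm_stokesBisector (k : ZMod 5) {t : ℝ} (ht : 0 ≤ t) : ‖stokesBisector k t‖ = t + 1 := by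
  rw [stokesBisector, norm_mul, Complex.norm_exp_ofReal_mul_I, mul_one, Complex.norm_real,
    Real.norm_of_nonneg (by linarith)]

lemma stokesAngle_stokesBisector (k : ZMod 5) {t : ℝ} (ht : 0 ≤ t) :
    stokesAngle k (stokesBisector k t) = 0 := by
  rw [stokesAngle, stokesBisector, mul_assoc, ← Complex.exp_add]
  rw [show ((2 * Real.pi * k.val / 5 : ℝ) : ℂ) * Complex.I +
    -(2 * Real.pi * (k.val : ℂ) / 5 * Complex.I) = 0 by push_cast; ring, Complex.exp_zero, mul_one]
  exact Complex.arg_ofReal_of_nonneg (by linarith)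

lemma stokesBisector_ne_zero (k : ZMod 5) {t : ℝ} (ht : 0 ≤ t) : stokesBisector k t ≠ 0 :=
  norm_ne_zero_iff.1 (by rw [norm_stokesBisector k ht]; linarith)

lemma tendsto_norm_stokesBisector (k : ZMod 5) :
    Tendsto (fun t => ‖stokesBisector k t‖) atTop atTop := by
  refine (tendsto_atTop_add_const_right atTop (1 : ℝ) tendsto_id).congr' ?_
  filter_upwards [eventually_ge_atTop 0] with t ht
  rw [norm_stokesBisector k ht]; rfl

lemma isNontangentialCurve_stokesBisector (k : ZMod 5) :
    IsNontangentialCurve k (stokesBisector k) where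
  continuousOn := by unfold stokesBisector; fun_prop
  mem_sector t ht := ⟨stokesBisector_ne_zero k ht, by
    rw [stokesAngle_stokesBisector k ht, abs_zero]; have := Real.pi_pos; positivity⟩
  tendsto_infinity := tendsto_norm_stokesBisector k
  nontangential := ⟨Real.pi / 5, by have := Real.pi_pos; positivity, by
    filter_upwards [eventually_ge_atTop 0] with t ht
    rw [stokesAngle_stokesBisector k ht]; simp⟩

lemma IsAsymptoticValue.unique {f : ℂ → OnePoint ℂ} {k : ZMod 5} {w w' : OnePoint ℂ}
    (h : IsAsymptoticValue f k w) (h' : IsAsymptoticValue f k w') : w = w' :=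
  tendsto_nhds_unique (h _ (isNontangentialCurve_stokesBisector k))
    (h' _ (isNontangentialCurve_stokesBisector k))

lemma IsNontangentialCurve.tendsto_stokesInterior {k : ZMod 5} {γ : ℝ → ℂ}
    (hγ : IsNontangentialCurve k γ) (δ : ℝ) :
    Tendsto γ atTop (Bornology.cobounded ℂ ⊓ 𝓟 (stokesInterior k δ)) := by
  have hcob : Tendsto γ atTop (Bornology.cobounded ℂ) :=
    tendsto_norm_atTop_iff_cobounded.1 hγ.tendsto_infinity
  refine tendsto_inf.2 ⟨hcob, tendsto_principal.2 ?_⟩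
  obtain ⟨ε, hε, hev⟩ := hγ.nontangential
  have hpi := Real.pi_pos
  have hεle : ε ≤ Real.pi / 5 := by
    obtain ⟨t, ht⟩ := hev.exists
    linarith [abs_nonneg (stokesAngle k (γ t))]
  have hsin : 0 < Real.sin ε := Real.sin_pos_of_pos_of_lt_pi hε (by linarith)
  filter_upwards [hev, hγ.tendsto_infinity.eventually_ge_atTop (δ / Real.sin ε),
    hγ.tendsto_infinity.eventually_gt_atTop 0] with t h1 h2 h3
  have hδ : δ ≤ ‖γ t‖ * Real.sin ε := (div_le_iff₀ hsin).1 h2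
  have h4 := abs_le.1 h1
  rcases le_total 0 (stokesAngle k (γ t)) with h | h
  · exact Or.inl (mem_belowRay_stokesBoundary (norm_pos_iff.1 h3) hε.le h h4.2 hδ)
  · exact Or.inr (mem_aboveRay_stokesBoundary (norm_pos_iff.1 h3) hε.le h h4.1 hδ)

lemma DecaysTo.sup {f : ℂ → OnePoint ℂ} {F G : Filter ℂ} {w : OnePoint ℂ}
    (hF : DecaysTo f F w) (hG : DecaysTo f G w) : DecaysTo f (F ⊔ G) w :=
  ⟨hF.1.sup hG.1, fun C => (hF.2 C).sup (hG.2 C)⟩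

/-- The potential differs from `4 l³` by `O(l)`. -/
lemma exists_potential_bound (O : Oscillator) : ∃ K R₀ : ℝ, ∀ l : ℂ, R₀ ≤ ‖l‖ →
    DifferentiableAt ℂ O.potential l ∧ ‖O.potential l - 4 * l ^ 3‖ ≤ K * ‖l‖ := by
  rcases O with ⟨y, y', z⟩ | ⟨a, b⟩
  · refine ⟨2 * ‖z‖ + ‖2 * z * y - 4 * y ^ 3 + y' ^ 2‖ + ‖y'‖ + 1, ‖y‖ + 1, fun l hl => ?_⟩
    have h1 : 1 ≤ ‖l - y‖ := by linarith [norm_sub_norm_le l y]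
    have hne : l - y ≠ 0 := norm_pos_iff.1 (by linarith)
    have hl1 : 1 ≤ ‖l‖ := by linarith [norm_nonneg y]
    constructor
    · simp only [Oscillator.potential]
      have hne2 : 4 * (l - y) ^ 2 ≠ 0 := by simp [hne]
      fun_prop (disch := assumption)
    · have e1 : ‖y' / (l - y)‖ ≤ ‖y'‖ := by
        rw [norm_div]; exact div_le_self (norm_nonneg _) h1
      have e2 : ‖3 / (4 * (l - y) ^ 2)‖ ≤ 1 := by
        rw [norm_div, norm_mul, norm_pow, Complex.norm_ofNat, Complex.norm_ofNat,
          div_le_one (by positivity)]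
        nlinarith
      have e3 : Oscillator.potential (.perturbed y y' z) l - 4 * l ^ 3 =
          -(2 * l * z) + (2 * z * y - 4 * y ^ 3 + y' ^ 2) + y' / (l - y) +
            3 / (4 * (l - y) ^ 2) := by
        simp only [Oscillator.potential]; ring
      rw [e3]
      calc _ ≤ ‖-(2 * l * z)‖ + ‖2 * z * y - 4 * y ^ 3 + y' ^ 2‖ + ‖y' / (l - y)‖ +
            ‖3 / (4 * (l - y) ^ 2)‖ := norm_add₄_le
        _ ≤ 2 * ‖l‖ * ‖z‖ + ‖2 * z * y - 4 * y ^ 3 + y' ^ 2‖ + ‖y'‖ + 1 := by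
          gcongr
          rw [norm_neg, norm_mul, norm_mul, Complex.norm_ofNat]
        _ ≤ _ := by
          nlinarith [mul_le_mul_of_nonneg_left hl1
            (by positivity : 0 ≤ ‖2 * z * y - 4 * y ^ 3 + y' ^ 2‖ + ‖y'‖ + 1)]
  · refine ⟨‖a‖ + ‖b‖, 1, fun l hl => ⟨?_, ?_⟩⟩
    · simp only [Oscillator.potential]
      fun_prop
    · have e3 : Oscillator.potential (.cubic a b) l - 4 * l ^ 3 = -(a * l) + -b := by
        simp only [Oscillator.potential]; ring
      rw [e3]
      refine (norm_add_le _ _).trans ?_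
      rw [norm_neg, norm_neg, norm_mul]
      nlinarith [mul_le_mul_of_nonneg_left hl (norm_nonneg b)]

/-- A solution of the Schwarzian equation decays, away from the boundary of each Stokes sector, to
a value attached to the sector, and the values attached to neighbouring sectors differ. The two
values obtained for `S_k` from its two boundary rays agree because they are both the limit along
the bisector. -/
lemma IsSchwarzianSolution.exists_decaysTo {O : Oscillator} {f : ℂ → OnePoint ℂ}
    (hf : IsSchwarzianSolution O f) : ∃ w : ZMod 5 → OnePoint ℂ, (∀ k, w (k + 1) ≠ w k) ∧
      ∀ k, ∀ δ : ℝ, 0 < δ →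
        DecaysTo f (Bornology.cobounded ℂ ⊓ 𝓟 (stokesInterior k δ)) (w k) := by
  obtain ⟨⟨F, hF, hFf, hS⟩, -⟩ := hf
  obtain ⟨K, R₀, hQ⟩ := exists_potential_bound O
  choose wa wb hne hdec using fun k : ZMod 5 => exists_decaysTo_aboveRay_belowRay hF hFf hS
    (fun l hl => (hQ l hl).1) (fun l hl => (hQ l hl).2) (norm_stokesBoundary k)
    (stokesBoundary_pow_five k)
  have hcons : ∀ k, wa (k - 1) = wb k := by
    intro k
    have hpi := Real.pi_pos
    have hsin : 0 < Real.sin (Real.pi / 5) :=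
      Real.sin_pos_of_pos_of_lt_pi (by positivity) (by linarith)
    have hcob : Tendsto (stokesBisector k) atTop (Bornology.cobounded ℂ) :=
      tendsto_norm_atTop_iff_cobounded.1 (tendsto_norm_stokesBisector k)
    have hb : Tendsto (stokesBisector k) atTop
        (Bornology.cobounded ℂ ⊓ 𝓟 (belowRay (stokesBoundary k) (Real.sin (Real.pi / 5)))) := by
      refine tendsto_inf.2 ⟨hcob, tendsto_principal.2 ?_⟩
      filter_upwards [eventually_ge_atTop 0] with t ht
      refine mem_belowRay_stokesBoundary (ε := Real.pi / 5) (stokesBisector_ne_zero k ht)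
        (by positivity)
        (stokesAngle_stokesBisector k ht).ge (by rw [stokesAngle_stokesBisector k ht]; simp) ?_
      rw [norm_stokesBisector k ht]
      nlinarith
    have ha : Tendsto (stokesBisector k) atTop
        (Bornology.cobounded ℂ ⊓
          𝓟 (aboveRay (stokesBoundary (k - 1)) (Real.sin (Real.pi / 5)))) := by
      refine tendsto_inf.2 ⟨hcob, tendsto_principal.2 ?_⟩
      filter_upwards [eventually_ge_atTop 0] with t ht
      refine mem_aboveRay_stokesBoundary (ε := Real.pi / 5) (stokesBisector_ne_zero k ht)
        (by positivity)
        (stokesAngle_stokesBisector k ht).le (by rw [stokesAngle_stokesBisector k ht]; simp) ?_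
      rw [norm_stokesBisector k ht]
      nlinarith
    exact tendsto_nhds_unique ((hdec (k - 1) _ hsin).1.1.comp ha) ((hdec k _ hsin).2.1.comp hb)
  refine ⟨wb, fun k => ?_, fun k δ hδ => ?_⟩
  · rw [← hcons (k + 1), add_sub_cancel_right]
    exact hne k
  · rw [stokesInterior, ← sup_principal, inf_sup_left]
    refine (hdec k δ hδ).2.sup ?_
    rw [← hcons k]
    exact (hdec (k - 1) δ hδ).1

/-! ### Rays -/

lemma rayPoint_div (l₀ c : ℂ) (α t : ℝ) :
    rayPoint l₀ α t / c = l₀ / c + t * (Complex.exp (α * Complex.I) / c) := by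
  rw [rayPoint]; ring

lemma stokesRotate_rayPoint (k : ZMod 5) (l₀ : ℂ) (α t : ℝ) :
    stokesRotate k (rayPoint l₀ α t) =
      stokesRotate k l₀ + t * stokesRotate k (Complex.exp (α * Complex.I)) := by
  rw [rayPoint, stokesRotate, stokesRotate, stokesRotate]; ring

lemma abs_sub_le_norm_rayPoint (l₀ : ℂ) (α t : ℝ) : |t| - ‖l₀‖ ≤ ‖rayPoint l₀ α t‖ := by
  have h := norm_sub_norm_le (t * Complex.exp (α * Complex.I)) (-l₀)
  rw [norm_mul, Complex.norm_exp_ofReal_mul_I, mul_one, Complex.norm_real, norm_neg,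
    sub_neg_eq_add, add_comm _ l₀] at h
  exact h

/-- An affine function has eventually constant sign. -/
lemma eventually_nonneg_or_eventually_nonpos (p q : ℝ) :
    (∀ᶠ t : ℝ in atTop, 0 ≤ p + t * q) ∨ ∀ᶠ t : ℝ in atTop, p + t * q ≤ 0 := by
  rcases lt_trichotomy q 0 with hq | rfl | hq
  · right
    filter_upwards [eventually_ge_atTop (-p / q)] with t ht
    rw [div_le_iff_of_neg hq] at ht
    linarith
  · rcases le_total 0 p with hp | hp
    · left; exact Eventually.of_forall fun t => by simpa using hp
    · right; exact Eventually.of_forall fun t => by simpa using hp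
  · left
    filter_upwards [eventually_ge_atTop (-p / q)] with t ht
    rw [div_le_iff₀ hq] at ht
    linarith

/-- An affine function that is positive on `(0, ∞)` is nondecreasing, so on `[1, ∞)` it is at least
its value at `1`. -/
lemma add_le_of_forall_pos {p q : ℝ} (h : ∀ t : ℝ, 0 < t → 0 < p + t * q) {t : ℝ} (ht : 1 ≤ t) :
    p + q ≤ p + t * q := by
  have hq : 0 ≤ q := by
    by_contra! hq
    have h1 := h (max 1 (-p / q)) (by positivity)
    have h2 := le_max_right 1 (-p / q)
    rw [div_le_iff_of_neg hq] at h2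
    linarith
  nlinarith

/-- A ray contained in `S_k` eventually stays at a positive distance from the boundary ray that is
nearer in angle, even when it is parallel to that boundary ray. -/
lemma exists_tendsto_rayPoint_stokesInterior {k : ZMod 5} {l₀ : ℂ} {α : ℝ}
    (h : ∀ t : ℝ, 0 < t → rayPoint l₀ α t ∈ stokesSector k) :
    ∃ δ : ℝ, 0 < δ ∧ Tendsto (rayPoint l₀ α) atTop
      (Bornology.cobounded ℂ ⊓ 𝓟 (stokesInterior k δ)) := by
  have hpi := Real.pi_pos
  have hcob : Tendsto (rayPoint l₀ α) atTop (Bornology.cobounded ℂ) := by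
    rw [← tendsto_norm_atTop_iff_cobounded]
    refine tendsto_atTop_mono (abs_sub_le_norm_rayPoint l₀ α) ?_
    simpa [sub_eq_add_neg] using
      tendsto_atTop_add_const_right atTop (-‖l₀‖) tendsto_abs_atTop_atTop
  have him : ∀ (a b : ℂ) (t : ℝ), (a + t * b).im = a.im + t * b.im := by
    intro a b t; simp
  have hsign : ∀ t, (stokesRotate k (rayPoint l₀ α t)).im =
      (stokesRotate k l₀).im + t * (stokesRotate k (Complex.exp (α * Complex.I))).im := by
    intro t; rw [stokesRotate_rayPoint, him]
  -- the ray is eventually in one of the halves into which the bisector divides `S_k`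
  rcases eventually_nonneg_or_eventually_nonpos (stokesRotate k l₀).im
    (stokesRotate k (Complex.exp (α * Complex.I))).im with hs | hs
  · have hneg : ∀ t : ℝ, 0 < t → 0 < -(l₀ / stokesBoundary k).im +
        t * -(Complex.exp (α * Complex.I) / stokesBoundary k).im := by
      intro t ht
      obtain ⟨h1, h2⟩ := h t ht
      have h3 : (rayPoint l₀ α t / stokesBoundary k).im < 0 := by
        rw [← Complex.arg_neg_iff, arg_div_stokesBoundary h1 h2.le]
        linarith [(abs_lt.1 h2).2]
      rw [rayPoint_div, him] at h3
      linarith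
    refine ⟨_, hneg 1 one_pos, tendsto_inf.2 ⟨hcob, tendsto_principal.2 ?_⟩⟩
    filter_upwards [hs, eventually_ge_atTop 1] with t h0 ht
    obtain ⟨h1, h2⟩ := h t (by linarith)
    have h3 : 0 ≤ stokesAngle k (rayPoint l₀ α t) := by
      rw [stokesAngle_eq_arg, Complex.arg_nonneg_iff, hsign]; exact h0
    refine Or.inl ⟨?_, ?_⟩
    · rw [arg_div_stokesBoundary h1 h2.le, abs_le]
      constructor <;> linarith [(abs_lt.1 h2).2]
    · have h4 := add_le_of_forall_pos hneg ht
      rw [rayPoint_div, him, one_mul]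
      linarith
  · have hpos : ∀ t : ℝ, 0 < t → 0 < (l₀ / stokesBoundary (k - 1)).im +
        t * (Complex.exp (α * Complex.I) / stokesBoundary (k - 1)).im := by
      intro t ht
      obtain ⟨h1, h2⟩ := h t ht
      have harg := arg_div_stokesBoundary_sub_one h1 h2.le
      have h2' := abs_lt.1 h2
      have h3 : 0 < (rayPoint l₀ α t / stokesBoundary (k - 1)).im := by
        rw [← Complex.norm_mul_sin_arg, harg]
        refine mul_pos (norm_pos_iff.2 (div_ne_zero h1 ?_))
          (Real.sin_pos_of_pos_of_lt_pi (by linarith) (by linarith))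
        exact Complex.exp_ne_zero _
      rwa [rayPoint_div, him] at h3
    refine ⟨_, hpos 1 one_pos, tendsto_inf.2 ⟨hcob, tendsto_principal.2 ?_⟩⟩
    filter_upwards [hs, eventually_ge_atTop 1] with t h0 ht
    obtain ⟨h1, h2⟩ := h t (by linarith)
    have h3 : stokesAngle k (rayPoint l₀ α t) ≤ 0 := by
      have h2' := abs_lt.1 h2
      by_contra! hcon
      have h4 : 0 < (stokesRotate k (rayPoint l₀ α t)).im := by
        rw [← Complex.norm_mul_sin_arg, ← stokesAngle_eq_arg, norm_stokesRotate]
        exact mul_pos (norm_pos_iff.2 h1)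
          (Real.sin_pos_of_pos_of_lt_pi hcon (by linarith))
      rw [hsign] at h4
      linarith
    refine Or.inr ⟨?_, ?_⟩
    · rw [arg_div_stokesBoundary_sub_one h1 h2.le, abs_le]
      constructor <;> linarith [(abs_lt.1 h2).1]
    · have h4 := add_le_of_forall_pos hpos ht
      rw [rayPoint_div, him, one_mul]
      linarith

lemma chordalDist_nonneg (p q : OnePoint ℂ) : 0 ≤ chordalDist p q := by
  rcases p with _ | u <;> rcases q with _ | v
  · exact le_rfl
  · change 0 ≤ 2 / √(1 + ‖v‖ ^ 2); positivity
  · change 0 ≤ 2 / √(1 + ‖u‖ ^ 2); positivity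
  · change 0 ≤ 2 * ‖u - v‖ / (√(1 + ‖u‖ ^ 2) * √(1 + ‖v‖ ^ 2)); positivity

/-- The modulus of a point of the ray is the parameter up to a bounded error, so that decay in the
modulus is decay in the parameter. -/
lemma DecaysTo.convergesSuperexponentially {f : ℂ → OnePoint ℂ} {F : Filter ℂ} {w : OnePoint ℂ}
    {l₀ : ℂ} {α : ℝ} (hf : DecaysTo f F w) (h : Tendsto (rayPoint l₀ α) atTop F) :
    ConvergesSuperexponentially f l₀ α w := by
  intro C
  have h1 := (((hf.2 |C|).comp h).const_mul (Real.exp (|C| * ‖l₀‖)))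
  rw [mul_zero] at h1
  refine squeeze_zero (fun t => mul_nonneg (Real.exp_pos _).le (chordalDist_nonneg _ _))
    (fun t => ?_) h1
  rw [Function.comp_apply, ← mul_assoc, ← Real.exp_add]
  refine mul_le_mul_of_nonneg_right (Real.exp_le_exp.2 ?_) (chordalDist_nonneg _ _)
  have h2 := abs_sub_le_norm_rayPoint l₀ α t
  calc C * t ≤ |C| * |t| := by rw [← abs_mul]; exact le_abs_self _
    _ ≤ |C| * (‖l₀‖ + ‖rayPoint l₀ α t‖) := by gcongr; linarith
    _ = _ := by ring

/-! ### Asymptotic values -/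

theorem mainTheorem2 (O : Oscillator) (f : ℂ → OnePoint ℂ) (hf : IsSchwarzianSolution O f) :
    (∀ k : ZMod 5, ∃! w : OnePoint ℂ, IsAsymptoticValue f k w) ∧
    (∀ (k : ZMod 5) (w w' : OnePoint ℂ),
      IsAsymptoticValue f k w → IsAsymptoticValue f (k + 1) w' → w' ≠ w) ∧
    (∀ (A : GL (Fin 2) ℂ) (k : ZMod 5) (w : OnePoint ℂ),
      IsAsymptoticValue f k w → IsAsymptoticValue (fun l => A • f l) k (A • w)) ∧
    (∀ (k : ZMod 5) (w : OnePoint ℂ), IsAsymptoticValue f k w →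
      ∀ (l₀ : ℂ) (α : ℝ), (∀ t : ℝ, 0 < t → rayPoint l₀ α t ∈ stokesSector k) →
        ConvergesSuperexponentially f l₀ α w) := by
  obtain ⟨v, hne, hdec⟩ := hf.exists_decaysTo
  have hv : ∀ k, IsAsymptoticValue f k (v k) := fun k γ hγ =>
    (hdec k 1 one_pos).1.comp (hγ.tendsto_stokesInterior 1)
  refine ⟨fun k => ⟨v k, hv k, fun w hw => hw.unique (hv k)⟩, ?_, ?_, ?_⟩
  · intro k w w' hw hw'
    rw [hw.unique (hv k), hw'.unique (hv (k + 1))]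
    exact hne k
  · intro A k w hw γ hγ
    exact ((continuous_GL_smul A).tendsto w).comp (hw γ hγ)
  · intro k w hw l₀ α hray
    obtain ⟨δ, hδ, h⟩ := exists_tendsto_rayPoint_stokesInterior hray
    rw [hw.unique (hv k)]
    exact (hdec k δ hδ).convergesSuperexponentially h
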